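/- Let $A \in \mathbb{R}^{n\times d}$, $b \in \mathbb{R}^n$, and let $x^* \in \mathbb{R}^d$ be any solution of $Ax=b$. Let $w$ be a random vector in $\mathbb{R}^n$ and let $w_0,w_1,w_2,\ldots$ be independent random vectors, each with the same distribution as $w$. Let $$\mathcal{N}(w) = \mathrm{span}\{ z \in \mathbb{R}^d : \mathbb{P}[z'A'w = 0] = 1\}, \qquad \mathcal{R}(w) = \mathcal{N}(w)^\perp,$$ and let $P_V$ denote the orthogonal projection onto a subspace $V$. Fix $x_0 \in \mathbb{R}^d$ and let, for $k \ge 0$, $$x_{k+1} = x_k + \frac{A'w_k\, w_k'(b - Ax_k)}{\|A'w_k\|_2^2},$$ where $x_{k+1} = x_k$ if $A'w_k = 0$. Define $\tau_1 = \min\{k \ge 0 : \mathrm{span}\{A'w_0,\ldots,A'w_k\} = \mathcal{R}(w)\}$ and, for $\ell \ge 2$, $\tau_\ell = \min\{k > \tau_{\ell-1} : \mathrm{span}\{A'w_{\tau_{\ell-1}+1},\ldots,A'w_k\} = \mathcal{R}(w)\}$, with $\min\emptyset = \infty$ and $\tau_\ell = \infty$ if $\tau_{\ell-1} = \infty$.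 The first block of indices is $B_1 = \{0,\ldots,\tau_1\}$, and $B_\ell = \{\tau_{\ell-1}+1,\ldots,\tau_\ell\}$ for $\ell \ge 2$. When $\tau_\ell < \infty$, let $\mathcal{F}_\ell$ be the collection of all matrices $F$ whose columns form a maximal linearly independent subset of the normalized vectors $\{A'w_i/\|A'w_i\|_2 : i \in B_\ell,\ A'w_i \ne 0\}$ (if $\mathcal{R}(w)=\{0\}$, almost surely the only such $F$ has no columns, and $\det(F'F)=1$), and let $\gamma_\ell = 1 - \min_{F\in\mathcal{F}_\ell} \det(F'F)$. Then $\tau_\ell < \infty$ almost surely for all $\ell \ge 1$; the random variables $\{\gamma_\ell\}_{\ell\ge1}$ are independent and identically distributed; $\mathbb{E}[\gamma_\ell] \in [0,1)$ for all $\ell \ge 1$; and $\mathbb{E}[\gamma_1] = 1 - \mathbb{E}[\min_{F \in \mathcal{F}_1}\det(F'F)] < 1$. For every $\delta > 1$, almost surely, for all sufficiently large $\ell$, $$\| x_{\tau_\ell+1} - x^* - P_{\mathcal{N}(w)}(x_0 - x^*) \|_2^2 \le \mathbb{E}[\gamma_1]^{\ell/\delta}\, \|P_{\mathcal{R}(w)}(x_0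 - x^*)\|_2^2 .$$ Moreover, $\mathbb{E}[\tau_1] < \infty$ and, almost surely, $\lim_{\ell\to\infty} \tau_\ell/\ell = \mathbb{E}[\tau_1] + 1$ (that is, the mean number $\mathbb{E}[\tau_1+1]$ of vectors in the first block). -/

import Mathlib

namespace RowAction

open MeasureTheory

/-- `ℝ^m` with the Euclidean norm and inner product. -/
abbrev Vec (m : ℕ) : Type := EuclideanSpace ℝ (Fin m)

/-- The matrix-vector product `M v`. -/
noncomputable def mulV {m p : ℕ} (M : Matrix (Fin m) (Fin p) ℝ) (v : Vec p) : Vec m :=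
  WithLp.toLp 2 (M.mulVec v.ofLp)

section Subspaces

variable {Ω : Type*} [MeasurableSpace Ω] {n d : ℕ}

/-- `𝒩(w)`: the span of all `z ∈ ℝ^d` such that `z' A' w = 0` with probability one. -/
noncomputable def nullSpan (μ : Measure Ω) (A : Matrix (Fin n) (Fin d) ℝ) (w : Ω → Vec n) :
    Submodule ℝ (Vec d) :=
  Submodule.span ℝ {z : Vec d | ∀ᵐ ω ∂μ, inner ℝ z (mulV A.transpose (w ω)) = 0}

/-- `ℛ(w) = 𝒩(w)^⊥`. -/
noncomputable def rowSpan (μ : Measure Ω) (A : Matrix (Fin n) (Fin d) ℝ) (w : Ω → Vec n) :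
    Submodule ℝ (Vec d) :=
  (nullSpan μ A w)ᗮ

end Subspaces

/-- The base row-action iteration
`x_{k+1} = x_k + A' w_k w_k' (b - A x_k) / ‖A' w_k‖²`.
If `A' w_k = 0` the second summand is the zero vector, so that `x_{k+1} = x_k`. -/
noncomputable def iter {n d : ℕ} (A : Matrix (Fin n) (Fin d) ℝ) (b : Vec n) (x₀ : Vec d)
    (w : ℕ → Vec n) : ℕ → Vec d
  | 0 => x₀
  | k + 1 =>
      iter A b x₀ w k +
        (inner ℝ (w k) (b - mulV A (iter A b x₀ w k)) / ‖mulV A.transpose (w k)‖ ^ 2) •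
          mulV A.transpose (w k)

section StoppingTimes

variable {d : ℕ}

/-- `min {k ≥ s : span {q_s, …, q_k} = R}`, equal to `⊤` if there is no such natural number `k`
(in particular if `s = ⊤`). -/
noncomputable def coverTime (R : Submodule ℝ (Vec d)) (q : ℕ → Vec d) (s : ℕ∞) : ℕ∞ :=
  sInf {t : ℕ∞ | ∃ k : ℕ, t = k ∧ s ≤ k ∧
    Submodule.span ℝ (q '' {i : ℕ | s ≤ i ∧ i ≤ k}) = R}

/-- The stopping times: `τ_0 = 0`, `τ_1 = min {k ≥ 0 : span {q_0, …, q_k} = R}` and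
`τ_ℓ = min {k > τ_{ℓ-1} : span {q_{τ_{ℓ-1}+1}, …, q_k} = R}` for `ℓ ≥ 2`
(so `τ_ℓ = ⊤` if `τ_{ℓ-1} = ⊤`). -/
noncomputable def tau (R : Submodule ℝ (Vec d)) (q : ℕ → Vec d) : ℕ → ℕ∞
  | 0 => 0
  | 1 => coverTime R q 0
  | l + 2 => coverTime R q (tau R q (l + 1) + 1)

/-- The index of the first vector of the `ℓ`-th block, `ℓ ≥ 1`: it is `0` for the first block,
and `τ_{ℓ-1} + 1` for the later ones. -/
noncomputable def blockStart (R : Submodule ℝ (Vec d)) (q : ℕ → Vec d) (l : ℕ) : ℕ∞ :=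
  if l ≤ 1 then 0 else tau R q (l - 1) + 1

/-- The set of indices of the `ℓ`-th block, `ℓ ≥ 1`, when `τ_ℓ` is finite: `{0, …, τ_1}` for
`ℓ = 1` and `{τ_{ℓ-1} + 1, …, τ_ℓ}` for `ℓ ≥ 2`. -/
noncomputable def block (R : Submodule ℝ (Vec d)) (q : ℕ → Vec d) (l : ℕ) : Finset ℕ :=
  Finset.Icc (blockStart R q l).toNat (tau R q l).toNat

end StoppingTimes

section Determinants

variable {d : ℕ}

/-- The matrix `F` whose columns are the vectors `v_j`, `j ∈ J`. -/
def colMatrix (v : ℕ → Vec d) (J : Finset ℕ) : Matrix (Fin d) J ℝ :=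
  Matrix.of fun i j => v j i

/-- `J` indexes a maximal linearly independent subset of `{v_i : i ∈ I}`. -/
def IsMaxIndep (v : ℕ → Vec d) (I J : Finset ℕ) : Prop :=
  Maximal (fun K : Finset ℕ => K ⊆ I ∧ LinearIndepOn ℝ v (K : Set ℕ)) J

/-- The values `det (F' F)`, where the columns of `F` form a maximal linearly independent subset
of `{v_i : i ∈ I}`. -/
def detSet (v : ℕ → Vec d) (I : Finset ℕ) : Set ℝ :=
  {D : ℝ | ∃ J : Finset ℕ, IsMaxIndep v I J ∧
    D = ((colMatrix v J).transpose * colMatrix v J).det}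

/-- `min det (F' F)` over the maximal linearly independent subsets of `{v_i : i ∈ I}`. -/
noncomputable def minDet (v : ℕ → Vec d) (I : Finset ℕ) : ℝ :=
  sInf (detSet v I)

/-- The infimum in `minDet` is an attained minimum. -/
theorem minDet_isLeast (v : ℕ → Vec d) (I : Finset ℕ) : IsLeast (detSet v I) (minDet v I) := by
  have hfin : {K : Finset ℕ | K ⊆ I ∧ LinearIndepOn ℝ v (K : Set ℕ)}.Finite :=
    (Finset.finite_toSet I.powerset).subset fun K hK => by simpa using hK.1
  have hne : (detSet v I).Nonempty := by
    obtain ⟨J, hJ⟩ := hfin.exists_maximal ⟨∅, by simp⟩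
    exact ⟨_, J, hJ, rfl⟩
  have hf : (detSet v I).Finite := by
    refine (hfin.image fun J => ((colMatrix v J).transpose * colMatrix v J).det).subset ?_
    rintro D ⟨J, hJ, rfl⟩
    exact ⟨J, hJ.prop, rfl⟩
  exact ⟨hne.csInf_mem hf, fun D hD => csInf_le hf.bddBelow hD⟩

/-- The minimum of `det (F' F)` over all `F ∈ ℱ_ℓ`, that is, over all matrices whose columns form
a maximal linearly independent subset of the normalized vectors `q_i / ‖q_i‖` of the `ℓ`-th block
(a zero vector `q_i` is left as it is and never belongs to a linearly independent subset). -/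
noncomputable def blockMinDet (R : Submodule ℝ (Vec d)) (q : ℕ → Vec d) (l : ℕ) : ℝ :=
  minDet (fun i => ‖q i‖⁻¹ • q i) (block R q l)

/-- `γ_ℓ = 1 - min_{F ∈ ℱ_ℓ} det (F' F)`. -/
noncomputable def gam (R : Submodule ℝ (Vec d)) (q : ℕ → Vec d) (l : ℕ) : ℝ :=
  1 - blockMinDet R q l

end Determinants

section RandomQuantities

variable {Ω : Type*} [MeasurableSpace Ω] {n d : ℕ}

/-- The random time `τ_ℓ` for the random vectors `A' w_0, A' w_1, …` and the subspace `ℛ(w)`. -/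
noncomputable def rtau (μ : Measure Ω) (A : Matrix (Fin n) (Fin d) ℝ) (w : Ω → Vec n)
    (ws : ℕ → Ω → Vec n) (l : ℕ) (ω : Ω) : ℕ∞ :=
  tau (rowSpan μ A w) (fun k => mulV A.transpose (ws k ω)) l

/-- The random variable `min_{F ∈ ℱ_ℓ} det (F' F)`. -/
noncomputable def rminDet (μ : Measure Ω) (A : Matrix (Fin n) (Fin d) ℝ) (w : Ω → Vec n)
    (ws : ℕ → Ω → Vec n) (l : ℕ) (ω : Ω) : ℝ :=
  blockMinDet (rowSpan μ A w) (fun k => mulV A.transpose (ws k ω)) l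

/-- The random variable `γ_ℓ`. -/
noncomputable def rgam (μ : Measure Ω) (A : Matrix (Fin n) (Fin d) ℝ) (w : Ω → Vec n)
    (ws : ℕ → Ω → Vec n) (l : ℕ) (ω : Ω) : ℝ :=
  gam (rowSpan μ A w) (fun k => mulV A.transpose (ws k ω)) l

end RandomQuantities

end RowAction

/-!
Write `q_k = A' w_k` and `e_k = x_k - x^*`. Since `A x^* = b`, the error evolves by
`e_{k+1} = e_k - ⟨v_k, e_k⟩ v_k` with `v_k = q_k / ‖q_k‖`, that is, by orthogonal projections.
Almost surely every `q_k` lies in `ℛ(w)`, so the component of the error in `𝒩(w)` is left fixed and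
the component in `ℛ(w)` stays there.

*Deterministic part.* Over a block whose vectors span `ℛ(w)`, the component in `ℛ(w)` contracts in
squared norm by the factor `γ = 1 - min det (F' F)`. This is Meany's inequality for a possibly
linearly dependent sequence (`exists_norm_sweep_sq_le`), proved by induction on the sequence, with
"Gram determinant = base times squared height" (`det_gram_sumElim`) as the algebraic input.
Multiplying over the blocks gives `norm_iter_start_sq_le`.

*Probabilistic part.* The law `ν` of `A' w` satisfies `ℛ(w) = span (supp ν)` (`rowSpan_eq`).
Points of the support that form a basis of `ℛ(w)` have neighbourhoods of positive measure in
which any choice of points is still linearly independent, so the covering time `τ_1` is at most the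
maximum of finitely many geometric times (`tsum_iidLaw_lt_cover_lt_top`); this gives
`τ_1 < ∞` almost surely and `𝔼 τ_1 < ∞`. The later blocks are the first block of the sequence
restarted after the previous one. By the strong Markov property (`measure_inter_restart`) every
functional of a block therefore gives an i.i.d. sequence (`iIndepFun_iterate_restart`), in
particular `γ_ℓ` and the lengths of the blocks.

*Limits.* The strong law of large numbers for the block lengths gives the limit of `τ_ℓ / ℓ`.
The strong law for `γ_ℓ`, together with the inequality of arithmetic and geometric means
`∏ γ_i ≤ ((∑ γ_i) / ℓ) ^ ℓ`, bounds the product of the contraction factors by `𝔼[γ_1] ^ (ℓ / δ)`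
for large `ℓ` (`eventually_prod_le_rpow`), since `𝔼[γ_1] < 𝔼[γ_1] ^ (1 / δ)` when
`0 < 𝔼[γ_1] < 1`.
-/

open MeasureTheory ProbabilityTheory Filter Topology
open scoped ENNReal

namespace RowAction

/-! ### Gram determinants of an enlarged family -/

section Gram

variable {E : Type*} [NormedAddCommGroup E] [InnerProductSpace ℝ E]

/-- Base times squared height: adjoining a vector `u` to a linearly independent family multiplies
the Gram determinant by the squared distance of `u` to the span. Here `∑ c_j v_j` is the
orthogonal projection of `u`. -/
theorem det_gram_sumElim {ι : Type*} [Fintype ι] [DecidableEq ι] {v : ι → E}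
    (hv : LinearIndependent ℝ v) (u : E) (c : ι → ℝ)
    (h : ∀ j, inner ℝ (v j) (u - ∑ i, c i • v i) = 0) :
    (Matrix.gram ℝ (Sum.elim (fun _ : Unit => u) v)).det =
      (Matrix.gram ℝ v).det * ‖u - ∑ i, c i • v i‖ ^ 2 := by
  set p := ∑ i, c i • v i with hp
  have hD : IsUnit (Matrix.gram ℝ v) :=
    (Matrix.isUnit_iff_isUnit_det _).2
      (isUnit_iff_ne_zero.2 (Matrix.det_gram_ne_zero_iff_linearIndependent.2 hv))
  have := hD.invertible
  have hblock : Matrix.gram ℝ (Sum.elim (fun _ : Unit => u) v) =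
      Matrix.fromBlocks (Matrix.of fun _ _ => inner ℝ u u) (Matrix.of fun _ j => inner ℝ u (v j))
        (Matrix.of fun i _ => inner ℝ (v i) u) (Matrix.gram ℝ v) := by
    ext (i | i) (j | j) <;> rfl
  have hC : (Matrix.of fun i (_ : Unit) => inner ℝ (v i) u) =
      Matrix.gram ℝ v * Matrix.of fun i (_ : Unit) => c i := by
    ext i j
    have := h i
    rw [inner_sub_right, sub_eq_zero] at this
    simp only [Matrix.of_apply, Matrix.mul_apply, Matrix.gram_apply, this, hp, inner_sum,
      inner_smul_right]
    exact Finset.sum_congr rfl fun _ _ => mul_comm _ _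
  have hup : inner ℝ p (u - p) = 0 := by
    conv_lhs => rw [hp, sum_inner]
    exact Finset.sum_eq_zero fun i _ => by rw [inner_smul_left, h i, mul_zero]
  -- By `hC` the Schur complement is the number `⟨u, u⟩ - ⟨u, p⟩ = ‖u - p‖²`.
  rw [hblock, Matrix.det_fromBlocks₂₂, Matrix.mul_assoc, hC, Matrix.invOf_mul_cancel_left,
    Matrix.det_unique (n := Unit)]
  congr 1
  have : inner ℝ u p = ∑ i, inner ℝ u (v i) * c i := by
    rw [hp, inner_sum]
    exact Finset.sum_congr rfl fun _ _ => by rw [inner_smul_right, mul_comm]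
  simp only [Matrix.sub_apply, Matrix.of_apply, Matrix.mul_apply, ← this]
  rw [← real_inner_self_eq_norm_sq, inner_sub_left, hup, sub_zero, inner_sub_right]

end Gram

/-! ### Meany's inequality -/

section Meany

variable {d : ℕ}

/-- The Gram determinant `det (F' F)` of the vectors `v_j`, `j ∈ J`. -/
noncomputable def gramDet (v : ℕ → Vec d) (J : Finset ℕ) : ℝ :=
  ((colMatrix v J).transpose * colMatrix v J).det

theorem gramDet_eq (v : ℕ → Vec d) (J : Finset ℕ) :
    gramDet v J = (Matrix.gram ℝ fun j : J => v j).det := by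
  unfold gramDet
  congr 1
  ext i j
  simp [Matrix.mul_apply, colMatrix, Matrix.gram_apply, PiLp.inner_apply, mul_comm]

theorem gramDet_empty (v : ℕ → Vec d) : gramDet v ∅ = 1 := Matrix.det_isEmpty

theorem linearIndepOn_iff_gramDet_ne_zero (v : ℕ → Vec d) (J : Finset ℕ) :
    LinearIndepOn ℝ v (J : Set ℕ) ↔ gramDet v J ≠ 0 := by
  rw [gramDet_eq, Matrix.det_gram_ne_zero_iff_linearIndependent]
  rfl

theorem gramDet_pos {v : ℕ → Vec d} {J : Finset ℕ} (hJ : LinearIndepOn ℝ v (J : Set ℕ)) :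
    0 < gramDet v J := by
  rw [gramDet_eq]
  exact (Matrix.posDef_gram_of_linearIndependent (v := fun j : J => v j) hJ).det_pos

theorem gramDet_insert {v : ℕ → Vec d} {J : Finset ℕ} {a : ℕ} (ha : a ∉ J)
    (hJ : LinearIndepOn ℝ v (J : Set ℕ)) :
    gramDet v (insert a J) =
      gramDet v J * ‖v a - (Submodule.span ℝ (v '' J)).starProjection (v a)‖ ^ 2 := by
  set V := Submodule.span ℝ (v '' J) with hV
  have hmem : V.starProjection (v a) ∈ Submodule.span ℝ (Set.range fun j : J => v j) := by
    have : (Set.range fun j : J => v j) = v '' J := by ext; simp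
    rw [this]
    exact Submodule.starProjection_apply_mem V (v a)
  obtain ⟨c, hc⟩ := (Submodule.mem_span_range_iff_exists_fun ℝ).1 hmem
  have h := det_gram_sumElim (v := fun j : J => v j) hJ (v a) c fun j => by
    rw [hc]
    exact Submodule.inner_right_of_mem_orthogonal
      (Submodule.subset_span (Set.mem_image_of_mem v j.2))
      (Submodule.sub_starProjection_mem_orthogonal (v a))
  rw [hc] at h
  rw [gramDet_eq, gramDet_eq, ← h]
  let e : J ⊕ Unit ≃ (insert a J : Finset ℕ) :=
    (Equiv.optionEquivSumPUnit J).symm.trans (Finset.subtypeInsertEquivOption ha).symm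
  rw [← Matrix.det_submatrix_equiv_self ((Equiv.sumComm _ _).trans e)]
  congr 1
  ext (i | i) (j | j) <;> rfl

/-- Hadamard's inequality for vectors of norm at most one. -/
theorem gramDet_le_one {v : ℕ → Vec d} (hv : ∀ i, ‖v i‖ ≤ 1) {J : Finset ℕ}
    (hJ : LinearIndepOn ℝ v (J : Set ℕ)) : gramDet v J ≤ 1 := by
  induction J using Finset.induction_on with
  | empty => rw [gramDet_empty]
  | insert a J ha ih =>
    have hJ' : LinearIndepOn ℝ v (J : Set ℕ) := hJ.mono (by simp)
    rw [gramDet_insert ha hJ']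
    have h1 : ‖v a - (Submodule.span ℝ (v '' J)).starProjection (v a)‖ ≤ 1 := by
      rw [← Submodule.starProjection_orthogonal_val]
      exact (Submodule.norm_starProjection_apply_le _ _).trans (hv a)
    exact mul_le_one₀ (ih hJ') (by positivity) (pow_le_one₀ (norm_nonneg _) h1)

/-- A linearly independent subfamily spanning the same space is a maximal one. -/
theorem isMaxIndep_of_span_eq {v : ℕ → Vec d} {I J : Finset ℕ} (hJI : J ⊆ I)
    (hJ : LinearIndepOn ℝ v (J : Set ℕ))
    (hspan : Submodule.span ℝ (v '' J) = Submodule.span ℝ (v '' I)) : IsMaxIndep v I J := by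
  refine ⟨⟨hJI, hJ⟩, fun K hK hJK a ha => ?_⟩
  by_contra haJ
  have hKind : LinearIndepOn ℝ v (K : Set ℕ) := hK.2
  refine (linearIndepOn_iff_notMem_span.1 hKind) a ha ?_
  have h1 : v a ∈ Submodule.span ℝ (v '' J) := by
    rw [hspan]
    exact Submodule.subset_span ⟨a, hK.1 ha, rfl⟩
  refine Submodule.span_mono (Set.image_mono fun j hj => ?_) h1
  exact ⟨hJK hj, fun h => haJ (by rwa [Set.mem_singleton_iff.1 h] at hj)⟩

/-- The step `x ↦ x - ⟨v, x⟩ v`: for a unit vector `v` the orthogonal projection onto `v^⊥`, for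
`v = 0` the identity. -/
noncomputable def step (v x : Vec d) : Vec d := x - inner ℝ v x • v

/-- The composition of the `m` steps along `v_a, v_{a+1}, …, v_{a+m-1}`, the first one being
applied first. -/
noncomputable def sweep (v : ℕ → Vec d) : ℕ → ℕ → Vec d → Vec d
  | _, 0, x => x
  | a, m + 1, x => sweep v (a + 1) m (step (v a) x)

theorem norm_step_sq {v : Vec d} (hv : ‖v‖ = 1 ∨ v = 0) (x : Vec d) :
    ‖step v x‖ ^ 2 = ‖x‖ ^ 2 - inner ℝ v x ^ 2 := by
  rcases hv with hv | rfl
  · rw [step, norm_sub_sq_real, inner_smul_right, norm_smul, hv, real_inner_comm, Real.norm_eq_abs,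
      mul_one, sq_abs]
    ring
  · simp [step]

theorem sweep_add_of_orthogonal (v : ℕ → Vec d) {z : Vec d} (a m : ℕ)
    (hz : ∀ i, a ≤ i → i < a + m → inner ℝ (v i) z = 0) (x : Vec d) :
    sweep v a m (x + z) = sweep v a m x + z := by
  induction m generalizing a x with
  | zero => rfl
  | succ m ih =>
    have : step (v a) (x + z) = step (v a) x + z := by
      simp only [step, inner_add_right, hz a le_rfl (by omega), add_zero]
      abel
    simp only [sweep, this]
    exact ih (a + 1) (fun i h1 h2 => hz i (by omega) (by omega)) _

theorem sweep_mem {v : ℕ → Vec d} {V : Submodule ℝ (Vec d)} (a m : ℕ)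
    (hv : ∀ i, a ≤ i → i < a + m → v i ∈ V) {x : Vec d} (hx : x ∈ V) : sweep v a m x ∈ V := by
  induction m generalizing a x with
  | zero => exact hx
  | succ m ih =>
    exact ih (a + 1) (fun i h1 h2 => hv i (by omega) (by omega))
      (V.sub_mem hx (V.smul_mem _ (hv a le_rfl (by omega))))

/-- If `y ⟂ u` lies in the span of a subspace `V` and a unit vector `u`, and `s` is the distance of
`u` to `V`, then the projection of `y` onto `V` has norm at least `s ‖y‖`. -/
theorem dist_mul_norm_le_norm_starProjection {V : Submodule ℝ (Vec d)} {u y : Vec d}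
    (hu : ‖u‖ = 1) (hy : y ∈ V ⊔ Submodule.span ℝ {u}) (huy : inner ℝ u y = 0) :
    ‖u - V.starProjection u‖ ^ 2 * ‖y‖ ^ 2 ≤ ‖V.starProjection y‖ ^ 2 := by
  set P := V.starProjection
  obtain ⟨z, hz, t, ht, rfl⟩ := Submodule.mem_sup.1 hy
  obtain ⟨c, rfl⟩ := Submodule.mem_span_singleton.1 ht
  have hPz : P z = z := Submodule.starProjection_eq_self_iff.2 hz
  have hPy : P (z + c • u) = z + c • P u := by rw [map_add, hPz, map_smul]
  set e := u - P u with he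
  have heV : ∀ q ∈ V, inner ℝ q e = 0 := fun q hq =>
    Submodule.inner_right_of_mem_orthogonal hq (Submodule.sub_starProjection_mem_orthogonal u)
  have hPu : P u ∈ V := Submodule.starProjection_apply_mem V u
  have hu' : u = P u + e := by rw [he]; abel
  set p := z + c • P u with hp
  have hpV : p ∈ V := V.add_mem hz (V.smul_mem _ hPu)
  have hy' : z + c • u = p + c • e := by
    rw [hp, he, smul_sub]; abel
  rw [hPy]
  have n1 : ‖z + c • u‖ ^ 2 = ‖p‖ ^ 2 + c ^ 2 * ‖e‖ ^ 2 := by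
    rw [hy', norm_add_sq_real, inner_smul_right, heV p hpV, norm_smul, Real.norm_eq_abs, mul_pow,
      sq_abs]
    ring
  have n2 : ‖P u‖ ^ 2 + ‖e‖ ^ 2 = 1 := by
    have : ‖u‖ ^ 2 = ‖P u‖ ^ 2 + ‖e‖ ^ 2 := by
      conv_lhs => rw [hu']
      rw [norm_add_sq_real, heV _ hPu]
      ring
    rw [← this, hu]
    norm_num
  -- The condition `⟨u, y⟩ = 0`, to which Cauchy–Schwarz is applied below.
  have n3 : inner ℝ (P u) p + c * ‖e‖ ^ 2 = 0 := by
    have h : inner ℝ u (p + c • e) = inner ℝ (P u) p + c * ‖e‖ ^ 2 := by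
      have hep : inner ℝ e p = 0 := by rw [real_inner_comm, heV p hpV]
      have hup : inner ℝ u p = inner ℝ (P u) p := by
        conv_lhs => rw [hu', inner_add_left, hep, add_zero]
      have hue : inner ℝ u e = ‖e‖ ^ 2 := by
        conv_lhs => rw [hu', inner_add_left, heV _ hPu, real_inner_self_eq_norm_sq, zero_add]
      rw [inner_add_right, inner_smul_right, hup, hue]
    rw [← h, ← hy', huy]
  have n4 : inner ℝ (P u) p ^ 2 ≤ ‖P u‖ ^ 2 * ‖p‖ ^ 2 := by
    rw [← mul_pow, ← sq_abs]
    exact pow_le_pow_left₀ (abs_nonneg _) (abs_real_inner_le_norm _ _) 2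
  rw [n1]
  have n5 : inner ℝ (P u) p = -(c * ‖e‖ ^ 2) := by linarith
  rw [n5] at n4
  have n6 : ‖P u‖ ^ 2 = 1 - ‖e‖ ^ 2 := by linarith
  rw [n6] at n4
  nlinarith [n4]

/-- Meany's inequality for a sequence of unit vectors that need not be linearly independent. The
induction removes the first vector `u`. If `u` lies in the span of the later ones, the step along
`u` shortens `x` and the same subfamily serves. Otherwise `u` is adjoined to the subfamily, whose
Gram determinant is then multiplied by the squared distance `s²` of `u` to the span of the later
vectors, and `‖P y‖ ≥ s ‖y‖` for `y ⟂ u` compensates for this factor. -/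
theorem exists_norm_sweep_sq_le {v : ℕ → Vec d} (hv : ∀ i, ‖v i‖ = 1 ∨ v i = 0) (a m : ℕ) :
    ∃ J ⊆ Finset.Ico a (a + m), LinearIndepOn ℝ v (J : Set ℕ) ∧
      Submodule.span ℝ (v '' J) = Submodule.span ℝ (v '' (Finset.Ico a (a + m) : Finset ℕ)) ∧
      ∀ x ∈ Submodule.span ℝ (v '' (Finset.Ico a (a + m) : Finset ℕ)),
        ‖sweep v a m x‖ ^ 2 ≤ (1 - gramDet v J) * ‖x‖ ^ 2 := by
  have hv1 : ∀ i, ‖v i‖ ≤ 1 := fun i => by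
    rcases hv i with h | h
    · exact h.le
    · simp [h]
  induction m generalizing a with
  | zero =>
    refine ⟨∅, by simp, by simp, by simp, fun x hx => ?_⟩
    simp only [add_zero, Finset.Ico_self, Finset.coe_empty, Set.image_empty, Submodule.span_empty,
      Submodule.mem_bot] at hx
    simp [hx, sweep]
  | succ m ih =>
    obtain ⟨J, hJI, hJ, hspan, hle⟩ := ih (a + 1)
    have hI : Finset.Ico a (a + (m + 1)) = insert a (Finset.Ico (a + 1) (a + 1 + m)) := by
      ext i; simp only [Finset.mem_Ico, Finset.mem_insert]; omega
    have haJ : a ∉ J := fun h => by have := Finset.mem_Ico.1 (hJI h); omega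
    rw [hI, Finset.coe_insert, Set.image_insert_eq, Submodule.span_insert]
    set V := Submodule.span ℝ (v '' (Finset.Ico (a + 1) (a + 1 + m) : Finset ℕ)) with hV
    have hvV : ∀ i, a + 1 ≤ i → i < a + 1 + m → v i ∈ V := fun i h1 h2 =>
      Submodule.subset_span ⟨i, by simp [h1, h2], rfl⟩
    have hdet0 := (gramDet_pos hJ).le
    have hdet1 := gramDet_le_one hv1 hJ
    by_cases haV : v a ∈ V
    · have hsup : Submodule.span ℝ {v a} ⊔ V = V :=
        sup_eq_right.2 ((Submodule.span_singleton_le_iff_mem _ _).2 haV)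
      rw [hsup]
      refine ⟨J, hJI.trans (Finset.subset_insert _ _), hJ, hspan, fun x hx => ?_⟩
      refine (hle _ (V.sub_mem hx (V.smul_mem _ haV))).trans ?_
      refine mul_le_mul_of_nonneg_left ?_ (by linarith)
      have := norm_step_sq (hv a) x
      rw [step] at this
      nlinarith [sq_nonneg (inner ℝ (v a) x)]
    · have hu : ‖v a‖ = 1 := (hv a).resolve_right fun h => haV (h ▸ V.zero_mem)
      refine ⟨insert a J, Finset.insert_subset_insert _ hJI, ?_, ?_, fun x hx => ?_⟩
      · rw [Finset.coe_insert, linearIndepOn_insert (by simpa using haJ), hspan]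
        exact ⟨hJ, haV⟩
      · rw [Finset.coe_insert, Set.image_insert_eq, Submodule.span_insert, hspan]
      rw [gramDet_insert haJ hJ, hspan]
      set y := step (v a) x with hy
      set P := V.starProjection
      set s := ‖v a - P (v a)‖
      have hyx : ‖y‖ ^ 2 = ‖x‖ ^ 2 - inner ℝ (v a) x ^ 2 := norm_step_sq (hv a) x
      have hyV : y ∈ V ⊔ Submodule.span ℝ {v a} := by
        rw [sup_comm]
        exact Submodule.sub_mem _ hx (Submodule.smul_mem _ _
          (Submodule.mem_sup_left (Submodule.mem_span_singleton_self _)))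
      have huy : inner ℝ (v a) y = 0 := by
        rw [hy, step, inner_sub_right, inner_smul_right, real_inner_self_eq_norm_sq, hu]
        ring
      have hkey := dist_mul_norm_le_norm_starProjection hu hyV huy
      have hPyV : P y ∈ V := Submodule.starProjection_apply_mem V y
      have horth : ∀ q ∈ V, inner ℝ q (y - P y) = 0 := fun q hq =>
        Submodule.inner_right_of_mem_orthogonal hq
          (Submodule.sub_starProjection_mem_orthogonal y)
      -- The later steps fix `y - P y`, which is orthogonal to all later vectors.
      have hsplit : sweep v a (m + 1) x = sweep v (a + 1) m (P y) + (y - P y) := by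
        rw [← sweep_add_of_orthogonal v (a + 1) m fun i h1 h2 => horth _ (hvV i h1 h2)]
        simp only [sweep, add_sub_cancel, hy]
      have hn1 : ‖sweep v a (m + 1) x‖ ^ 2 =
          ‖sweep v (a + 1) m (P y)‖ ^ 2 + ‖y - P y‖ ^ 2 := by
        rw [hsplit, norm_add_sq_real, horth _ (sweep_mem (a + 1) m hvV hPyV)]
        ring
      have hn2 : ‖y‖ ^ 2 = ‖P y‖ ^ 2 + ‖y - P y‖ ^ 2 := by
        have : y = P y + (y - P y) := by abel
        conv_lhs => rw [this]
        rw [norm_add_sq_real, horth _ hPyV]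
        ring
      have hs1 : s ^ 2 ≤ 1 := by
        have : s ≤ 1 := by
          change ‖v a - V.starProjection (v a)‖ ≤ 1
          rw [← Submodule.starProjection_orthogonal_val]
          exact (Submodule.norm_starProjection_apply_le _ _).trans (hv1 a)
        exact pow_le_one₀ (norm_nonneg _) this
      have h1 := hle _ hPyV
      have hA := sq_nonneg (inner ℝ (v a) x)
      have hD : gramDet v J * s ^ 2 ≤ 1 := mul_le_one₀ hdet1 (sq_nonneg _) hs1
      -- With `D = gramDet v J` it remains to combine `D s² ‖y‖² ≤ D ‖P y‖²` with
      -- `D s² ⟨u, x⟩² ≤ ⟨u, x⟩²`.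
      have h2 : gramDet v J * (s ^ 2 * ‖y‖ ^ 2) ≤ gramDet v J * ‖P y‖ ^ 2 :=
        mul_le_mul_of_nonneg_left hkey hdet0
      have h3 := mul_le_mul_of_nonneg_right hD hA
      rw [hn1]
      rw [hyx] at h2 hn2
      linarith

end Meany

/-! ### The strong Markov property of i.i.d. sequences -/

section Renewal

theorem measurable_apply_nat {X β : Type*} [MeasurableSpace X] [MeasurableSpace β]
    {F : ℕ → X → β} (hF : ∀ k, Measurable (F k)) {t : X → ℕ} (ht : Measurable t) :
    Measurable fun x => F (t x) x := by
  have h : Measurable fun p : ℕ × X => F p.1 p.2 := measurable_from_prod_countable_right hF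
  exact h.comp (ht.prodMk measurable_id)

variable {S : Type*} [MeasurableSpace S]

/-- The sequence `y_s, y_{s+1}, …`. -/
def shiftSeq (s : ℕ) (y : ℕ → S) : ℕ → S := fun i => y (s + i)

/-- The sequence `y_0, …, y_k, y_k, y_k, …`, which carries the same information as
`y_0, …, y_k`. -/
def stopSeq (k : ℕ) (y : ℕ → S) : ℕ → S := fun i => y (min i k)

/-- The sequence that remains after the index `T y`; it is `shiftSeq 1 y` if `T y = ⊤`. -/
def restart (T : (ℕ → S) → ℕ∞) (y : ℕ → S) : ℕ → S := shiftSeq ((T y).toNat + 1) y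

/-- `T` is a stopping time of the coordinate process: whether `T = k` is decided by the coordinates
`0, …, k`. -/
structure IsStopping (T : (ℕ → S) → ℕ∞) : Prop where
  measurable : Measurable T
  eq_iff_stopSeq : ∀ (y : ℕ → S) (k : ℕ), T y = k ↔ T (stopSeq k y) = k

/-- The function `g` depends only on the coordinates `0, …, T`, on `T < ⊤`. -/
def DependsUpTo {β : Type*} (T : (ℕ → S) → ℕ∞) (g : (ℕ → S) → β) : Prop :=
  ∀ (y : ℕ → S) (k : ℕ), T y = k → g (stopSeq k y) = g y

theorem measurable_shiftSeq (s : ℕ) : Measurable (shiftSeq s : (ℕ → S) → ℕ → S) :=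
  measurable_pi_lambda _ fun _ => measurable_pi_apply _

theorem IsStopping.measurable_restart {T : (ℕ → S) → ℕ∞} (hT : IsStopping T) :
    Measurable (restart T) := by
  refine measurable_pi_lambda _ fun i => ?_
  exact measurable_apply_nat (F := fun k y => y (k + 1 + i)) (fun k => measurable_pi_apply _)
    (Measurable.of_discrete.comp hT.measurable (g := ENat.toNat))

/-- The law of a sequence of independent random variables with law `ν`. -/
noncomputable def iidLaw (ν : Measure S) : Measure (ℕ → S) := Measure.infinitePi fun _ : ℕ => ν

theorem measure_eq_tsum_eq {ν : Measure S} {T : (ℕ → S) → ℕ∞} (hT : IsStopping T)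
    (hfin : ∀ᵐ y ∂iidLaw ν, T y ≠ ⊤) {B : Set (ℕ → S)} (hB : MeasurableSet B) :
    iidLaw ν B = ∑' k : ℕ, iidLaw ν ({y | T y = k} ∩ B) := by
  have hm : ∀ k : ℕ, MeasurableSet {y | T y = k} := fun k =>
    hT.measurable (measurableSet_singleton _)
  rw [← measure_iUnion]
  · refine measure_congr ?_
    filter_upwards [hfin] with y hy
    obtain ⟨k, hk⟩ := ENat.ne_top_iff_exists.1 hy
    refine propext ⟨fun h => Set.mem_iUnion.2 ⟨k, hk.symm, h⟩, fun h => ?_⟩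
    obtain ⟨j, hj⟩ := Set.mem_iUnion.1 h
    exact hj.2
  · intro i j hij
    refine Set.disjoint_left.2 fun y hy hy' => hij ?_
    have := hy.1.symm.trans hy'.1
    exact_mod_cast this
  · exact fun k => (hm k).inter hB

variable (ν : Measure S) [IsProbabilityMeasure ν]

instance : IsProbabilityMeasure (iidLaw ν) := by unfold iidLaw; infer_instance

theorem map_shiftSeq_iidLaw (s : ℕ) : (iidLaw ν).map (shiftSeq s) = iidLaw ν :=
  Measure.map_infinitePi_infinitePi_of_inj (f := fun i : ℕ => s + i) (add_right_injective s)

theorem indepFun_stopSeq_shiftSeq (k : ℕ) :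
    IndepFun (stopSeq k) (shiftSeq (k + 1)) (iidLaw ν) := by
  have hind : iIndepFun (fun (i : ℕ) (y : ℕ → S) => y i) (iidLaw ν) :=
    iIndepFun_infinitePi (P := fun _ : ℕ => ν) (X := fun _ x => x) fun _ => measurable_id
  have h := indep_iSup_of_disjoint (fun i => (measurable_pi_apply i).comap_le) hind
    (S := Set.Iic k) (T := Set.Ioi k) (Set.Iic_disjoint_Ioi le_rfl)
  rw [IndepFun_iff_Indep]
  refine indep_of_indep_of_le_left (indep_of_indep_of_le_right h ?_) ?_
  · rw [MeasurableSpace.pi, MeasurableSpace.comap_iSup]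
    refine iSup_le fun i => ?_
    rw [MeasurableSpace.comap_comp]
    exact le_iSup₂_of_le (k + 1 + i) (by simp; omega) le_rfl
  · rw [MeasurableSpace.pi, MeasurableSpace.comap_iSup]
    refine iSup_le fun i => ?_
    rw [MeasurableSpace.comap_comp]
    exact le_iSup₂_of_le (min i k) (by simp) le_rfl

variable {ν} {T : (ℕ → S) → ℕ∞}

/-- The strong Markov property of an i.i.d. sequence at an almost surely finite stopping time: the
sequence after `T` is independent of the past up to `T` and again has law `iidLaw ν`. -/
theorem measure_inter_restart (hT : IsStopping T) (hfin : ∀ᵐ y ∂iidLaw ν, T y ≠ ⊤)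
    {B C : Set (ℕ → S)} (hB : MeasurableSet B) (hBT : DependsUpTo T (· ∈ B))
    (hC : MeasurableSet C) :
    iidLaw ν (B ∩ restart T ⁻¹' C) = iidLaw ν B * iidLaw ν C := by
  rw [measure_eq_tsum_eq hT hfin (hB.inter (hT.measurable_restart hC)),
    measure_eq_tsum_eq hT hfin hB, ← ENNReal.tsum_mul_right]
  refine tsum_congr fun k => ?_
  -- The past event `{T = k} ∩ B` is a function of `y_0, …, y_k`.
  have hset : {y | T y = k} ∩ B = stopSeq k ⁻¹' ({y | T y = k} ∩ B) := by
    ext y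
    change (T y = k ∧ y ∈ B) ↔ (T (stopSeq k y) = k ∧ stopSeq k y ∈ B)
    rw [← hT.eq_iff_stopSeq]
    exact and_congr_right fun h => (hBT y k h).symm.to_iff
  have hset' : {y | T y = k} ∩ (B ∩ restart T ⁻¹' C) =
      stopSeq k ⁻¹' ({y | T y = k} ∩ B) ∩ shiftSeq (k + 1) ⁻¹' C := by
    rw [← hset]
    ext y
    simp only [Set.mem_inter_iff, Set.mem_ofPred_eq, Set.mem_preimage, and_assoc]
    refine and_congr_right fun h => and_congr_right fun _ => ?_
    rw [restart, h, ENat.toNat_natCast]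
  have hmeas : MeasurableSet ({y | T y = k} ∩ B) :=
    (hT.measurable (measurableSet_singleton (k : ℕ∞))).inter hB
  rw [hset', (indepFun_stopSeq_shiftSeq ν k).measure_inter_preimage_eq_mul _ _ hmeas hC, ← hset,
    ← Measure.map_apply (measurable_shiftSeq _) hC, map_shiftSeq_iidLaw]

theorem map_restart_iidLaw (hT : IsStopping T) (hfin : ∀ᵐ y ∂iidLaw ν, T y ≠ ⊤) :
    (iidLaw ν).map (restart T) = iidLaw ν := by
  ext C hC
  have := measure_inter_restart hT hfin .univ (fun _ _ _ => rfl) hC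
  rwa [Set.univ_inter, measure_univ, one_mul, ← Measure.map_apply hT.measurable_restart hC] at this

theorem measurable_iterate_restart (hT : IsStopping T) (l : ℕ) : Measurable (restart T)^[l] :=
  hT.measurable_restart.iterate l

theorem map_iterate_restart_iidLaw (hT : IsStopping T) (hfin : ∀ᵐ y ∂iidLaw ν, T y ≠ ⊤) (l : ℕ) :
    (iidLaw ν).map (restart T)^[l] = iidLaw ν := by
  induction l with
  | zero => simp
  | succ l ih =>
    rw [Function.iterate_succ, ← Measure.map_map (measurable_iterate_restart hT l)
      hT.measurable_restart, map_restart_iidLaw hT hfin, ih]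

theorem ae_forall_iterate_restart_ne_top (hT : IsStopping T)
    (hfin : ∀ᵐ y ∂iidLaw ν, T y ≠ ⊤) : ∀ᵐ y ∂iidLaw ν, ∀ l, T ((restart T)^[l] y) ≠ ⊤ := by
  refine ae_all_iff.2 fun l => ?_
  have h := hfin
  rw [← map_iterate_restart_iidLaw hT hfin l] at h
  exact ae_of_ae_map (measurable_iterate_restart hT l).aemeasurable h

theorem identDistrib_iterate_restart {β : Type*} [MeasurableSpace β] {g : (ℕ → S) → β}
    (hT : IsStopping T) (hfin : ∀ᵐ y ∂iidLaw ν, T y ≠ ⊤) (hg : Measurable g) (l : ℕ) :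
    IdentDistrib (fun y => g ((restart T)^[l] y)) g (iidLaw ν) (iidLaw ν) where
  aemeasurable_fst := (hg.comp (measurable_iterate_restart hT l)).aemeasurable
  aemeasurable_snd := hg.aemeasurable
  map_eq := by
    have := Measure.map_map (μ := iidLaw ν) hg (measurable_iterate_restart hT l)
    rw [map_iterate_restart_iidLaw hT hfin] at this
    exact this.symm

/-- The successive values of a functional of the block that ends at `T` are independent. -/
theorem iIndepFun_iterate_restart {β : Type*} [MeasurableSpace β] {g : (ℕ → S) → β}
    (hT : IsStopping T) (hfin : ∀ᵐ y ∂iidLaw ν, T y ≠ ⊤) (hg : Measurable g)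
    (hgT : DependsUpTo T g) :
    iIndepFun (fun l y => g ((restart T)^[l] y)) (iidLaw ν) := by
  have key : ∀ (n : ℕ) (A : ℕ → Set β), (∀ i, MeasurableSet (A i)) →
      iidLaw ν (⋂ i ∈ Finset.range n, (fun y => g ((restart T)^[i] y)) ⁻¹' A i) =
        ∏ i ∈ Finset.range n, iidLaw ν (g ⁻¹' A i) := by
    intro n
    induction n with
    | zero => intro A _; simp
    | succ n ih =>
      intro A hA
      have hC : MeasurableSet
          (⋂ i ∈ Finset.range n, (fun y => g ((restart T)^[i] y)) ⁻¹' A (i + 1)) :=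
        Finset.measurableSet_biInter _ fun i _ =>
          (hg.comp (measurable_iterate_restart hT i)) (hA _)
      rw [Finset.prod_range_succ', ← ih (fun i => A (i + 1)) fun i => hA _, mul_comm,
        ← measure_inter_restart hT hfin (hg (hA 0))
          (fun y k h => by simp only [Set.mem_preimage, hgT y k h]) hC]
      congr 1
      ext y
      simp only [Set.mem_iInter, Finset.mem_range, Set.mem_preimage, Set.mem_inter_iff,
        ← Function.iterate_succ_apply]
      refine ⟨fun h => ⟨h 0 (by omega), fun i hi => h (i + 1) (by omega)⟩, fun h i hi => ?_⟩
      rcases i with _ | i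
      · exact h.1
      · exact h.2 i (by omega)
  rw [iIndepFun_iff_measure_inter_preimage_eq_mul]
  intro F A hA
  classical
  -- The indices outside `F` are filled up with trivial conditions, to reach an initial segment.
  let A' : ℕ → Set β := fun i => if i ∈ F then A i else Set.univ
  have hA' : ∀ i, MeasurableSet (A' i) := fun i => by
    by_cases h : i ∈ F
    · simp only [A', h, if_true, hA i h]
    · simp only [A', h, if_false, MeasurableSet.univ]
  obtain ⟨n, hn⟩ := Finset.exists_nat_subset_range F
  have h1 := key n A' hA'
  have h2 : ⋂ i ∈ Finset.range n, (fun y => g ((restart T)^[i] y)) ⁻¹' A' i =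
      ⋂ i ∈ F, (fun y => g ((restart T)^[i] y)) ⁻¹' A i := by
    ext y
    simp only [Set.mem_iInter, Set.mem_preimage]
    refine ⟨fun h i hi => by simpa [A', hi] using h i (hn hi), fun h i _ => ?_⟩
    by_cases hi : i ∈ F
    · simpa [A', hi] using h i hi
    · simp [A', hi]
  rw [h2, ← Finset.prod_subset hn fun i _ hi => by simp [A', hi]] at h1
  rw [h1]
  refine Finset.prod_congr rfl fun i hi => ?_
  have := (identDistrib_iterate_restart hT hfin hg i).measure_mem_eq (hA i hi)
  rw [this]
  simp [A', hi]

end Renewal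

/-! ### Covering times and blocks -/

section Cover

variable {d : ℕ} {R : Submodule ℝ (Vec d)}

theorem sInf_natCast_eq_iff {p : ℕ → Prop} {k : ℕ} :
    sInf {t : ℕ∞ | ∃ k : ℕ, t = k ∧ p k} = k ↔ p k ∧ ∀ j < k, ¬ p j := by
  constructor
  · intro h
    have hne : {t : ℕ∞ | ∃ k : ℕ, t = k ∧ p k}.Nonempty := by
      by_contra hne
      rw [Set.not_nonempty_iff_eq_empty.1 hne, sInf_empty] at h
      exact ENat.natCast_ne_top k h.symm
    obtain ⟨j, hj, hpj⟩ := csInf_mem hne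
    have hkj : k = j := by exact_mod_cast h.symm.trans hj
    refine ⟨hkj ▸ hpj, fun i hi hpi => ?_⟩
    have : sInf {t : ℕ∞ | ∃ k : ℕ, t = k ∧ p k} ≤ i := sInf_le ⟨i, rfl, hpi⟩
    rw [h] at this
    exact absurd (by exact_mod_cast this) (not_le.2 hi)
  · rintro ⟨hk, hmin⟩
    refine IsLeast.csInf_eq ⟨⟨k, rfl, hk⟩, ?_⟩
    rintro _ ⟨j, rfl, hj⟩
    exact_mod_cast not_lt.1 fun hlt => hmin j hlt hj

/-- The first time at which the vectors `q_0, q_1, …` span `R`. -/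
noncomputable def cover (R : Submodule ℝ (Vec d)) (q : ℕ → Vec d) : ℕ∞ := coverTime R q 0

theorem cover_eq_iff {q : ℕ → Vec d} {k : ℕ} :
    cover R q = k ↔ Submodule.span ℝ (q '' Set.Iic k) = R ∧
      ∀ j < k, Submodule.span ℝ (q '' Set.Iic j) ≠ R := by
  have h : ∀ j : ℕ, {i : ℕ | (0 : ℕ∞) ≤ i ∧ i ≤ j} = Set.Iic j := fun j => by ext; simp
  rw [cover, coverTime, sInf_natCast_eq_iff]
  simp only [zero_le, true_and, ← h]

theorem coverTime_eq_add {q : ℕ → Vec d} {s k : ℕ} (h : cover R (shiftSeq s q) = k) :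
    coverTime R q s = (s + k : ℕ) := by
  have himg : ∀ j : ℕ, shiftSeq s q '' Set.Iic j = q '' {i : ℕ | s ≤ i ∧ i ≤ s + j} := fun j => by
    ext x
    constructor
    · rintro ⟨i, hi, rfl⟩
      exact ⟨s + i, ⟨by omega, by have := Set.mem_Iic.1 hi; omega⟩, rfl⟩
    · rintro ⟨i, ⟨h1, h2⟩, rfl⟩
      exact ⟨i - s, Set.mem_Iic.2 (by omega), by simp only [shiftSeq]; congr 1; omega⟩
  rw [cover_eq_iff] at h
  rw [coverTime, sInf_natCast_eq_iff]
  simp only [Nat.cast_le]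
  refine ⟨⟨by omega, by rw [← himg]; exact h.1⟩, fun j hj hp => ?_⟩
  obtain ⟨i, rfl⟩ := Nat.exists_eq_add_of_le hp.1
  exact h.2 i (by omega) (by rw [himg]; exact hp.2)

/-- The index at which the `(l+1)`-st block starts, if the earlier blocks are finite. -/
noncomputable def start (R : Submodule ℝ (Vec d)) (q : ℕ → Vec d) (l : ℕ) : ℕ :=
  ∑ i ∈ Finset.range l, ((cover R ((restart (cover R))^[i] q)).toNat + 1)

theorem start_succ (q : ℕ → Vec d) (l : ℕ) :
    start R q (l + 1) = start R q l + ((cover R ((restart (cover R))^[l] q)).toNat + 1) :=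
  Finset.sum_range_succ _ _

theorem iterate_restart_eq_shiftSeq (q : ℕ → Vec d) (l : ℕ) :
    (restart (cover R))^[l] q = shiftSeq (start R q l) q := by
  induction l with
  | zero => funext i; simp [shiftSeq, start]
  | succ l ih =>
    rw [Function.iterate_succ_apply', restart, start_succ]
    conv_lhs => rw [ih]
    funext i
    simp only [shiftSeq, ih]
    congr 1
    omega

theorem tau_succ {q : ℕ → Vec d} (h : ∀ l, cover R ((restart (cover R))^[l] q) ≠ ⊤) (l : ℕ) :
    tau R q (l + 1) =
      (start R q l + (cover R ((restart (cover R))^[l] q)).toNat : ℕ) := by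
  have hstep : ∀ l, coverTime R q (start R q l : ℕ) =
      (start R q l + (cover R ((restart (cover R))^[l] q)).toNat : ℕ) := fun l =>
    coverTime_eq_add (by rw [← iterate_restart_eq_shiftSeq, ENat.natCast_toNat (h l)])
  induction l with
  | zero =>
    have := hstep 0
    simpa [start, tau] using this
  | succ l ih =>
    rw [← hstep (l + 1), tau, ih, start_succ]
    push_cast
    rw [add_assoc]

theorem toNat_tau_succ_add_one {q : ℕ → Vec d}
    (h : ∀ l, cover R ((restart (cover R))^[l] q) ≠ ⊤) (l : ℕ) :
    (tau R q (l + 1)).toNat + 1 = start R q (l + 1) := by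
  rw [tau_succ h, ENat.toNat_natCast, start_succ, add_assoc]

theorem block_succ {q : ℕ → Vec d} (h : ∀ l, cover R ((restart (cover R))^[l] q) ≠ ⊤) (l : ℕ) :
    block R q (l + 1) = Finset.Icc (start R q l)
      (start R q l + (cover R ((restart (cover R))^[l] q)).toNat) := by
  have hs : blockStart R q (l + 1) = start R q l := by
    rcases l with _ | l
    · simp [blockStart, start]
    · rw [blockStart, if_neg (by omega), Nat.add_sub_cancel, ← toNat_tau_succ_add_one h, tau_succ h,
        ENat.toNat_natCast]
      push_cast
      rfl
  rw [block, hs, tau_succ h, ENat.toNat_natCast, ENat.toNat_natCast]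

theorem block_one (q : ℕ → Vec d) : block R q 1 = Finset.Icc 0 (cover R q).toNat := by
  simp [block, blockStart, tau, cover]

end Cover

/-! ### Minimal Gram determinants of a block -/

section MinDet

variable {d : ℕ}

theorem gramDet_map (v : ℕ → Vec d) (e : ℕ ↪ ℕ) (J : Finset ℕ) :
    gramDet v (J.map e) = gramDet (v ∘ e) J := by
  rw [gramDet_eq, gramDet_eq, ← Matrix.det_submatrix_equiv_self (Finset.equivMap (f := e) (s := J))]
  rfl

theorem gramDet_congr {v v' : ℕ → Vec d} {J : Finset ℕ} (h : ∀ i ∈ J, v i = v' i) :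
    gramDet v J = gramDet v' J := by
  rw [gramDet_eq, gramDet_eq]
  congr 2
  funext j
  exact h j j.2

/-- The condition `IsMaxIndep` in terms of Gram determinants. -/
theorem isMaxIndep_iff (v : ℕ → Vec d) (I J : Finset ℕ) :
    IsMaxIndep v I J ↔ (J ⊆ I ∧ gramDet v J ≠ 0) ∧
      ∀ K, K ⊆ I → gramDet v K ≠ 0 → J ⊆ K → K ⊆ J := by
  simp only [IsMaxIndep, Maximal, linearIndepOn_iff_gramDet_ne_zero, and_imp]

theorem isMaxIndep_map (v : ℕ → Vec d) (e : ℕ ↪ ℕ) (I J : Finset ℕ) :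
    IsMaxIndep v (I.map e) (J.map e) ↔ IsMaxIndep (v ∘ e) I J := by
  rw [isMaxIndep_iff, isMaxIndep_iff]
  refine and_congr (by rw [Finset.map_subset_map, gramDet_map]) ⟨fun h K h1 h2 h3 => ?_, ?_⟩
  · have := h (K.map e) (Finset.map_subset_map.2 h1) (by rwa [gramDet_map])
      (Finset.map_subset_map.2 h3)
    exact Finset.map_subset_map.1 this
  · intro h K h1 h2 h3
    obtain ⟨K, hK, rfl⟩ := Finset.subset_map_iff.1 h1
    rw [gramDet_map] at h2
    exact Finset.map_subset_map.2 (h K hK h2 (Finset.map_subset_map.1 h3))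

theorem minDet_map (v : ℕ → Vec d) (e : ℕ ↪ ℕ) (I : Finset ℕ) :
    minDet v (I.map e) = minDet (v ∘ e) I := by
  unfold minDet
  congr 1
  ext D
  constructor
  · rintro ⟨J, hJ, rfl⟩
    obtain ⟨J, -, rfl⟩ := Finset.subset_map_iff.1 hJ.prop.1
    exact ⟨J, (isMaxIndep_map v e I J).1 hJ, gramDet_map v e J⟩
  · rintro ⟨J, hJ, rfl⟩
    exact ⟨J.map e, (isMaxIndep_map v e I J).2 hJ, (gramDet_map v e J).symm⟩

theorem minDet_congr {v v' : ℕ → Vec d} {I : Finset ℕ} (h : ∀ i ∈ I, v i = v' i) :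
    minDet v I = minDet v' I := by
  have key : ∀ {v v' : ℕ → Vec d}, (∀ i ∈ I, v i = v' i) → detSet v I ⊆ detSet v' I := by
    rintro v v' h D ⟨J, hJ, rfl⟩
    have hg : ∀ K ⊆ I, gramDet v K = gramDet v' K := fun K hK =>
      gramDet_congr fun i hi => h i (hK hi)
    refine ⟨J, ?_, hg J hJ.prop.1⟩
    rw [isMaxIndep_iff] at hJ ⊢
    exact ⟨⟨hJ.1.1, hg J hJ.1.1 ▸ hJ.1.2⟩, fun K hK h1 => hJ.2 K hK (by rwa [hg K hK])⟩
  unfold minDet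
  rw [(key h).antisymm (key fun i hi => (h i hi).symm)]

/-- The vectors scaled to norm one, zero vectors being left as they are. -/
noncomputable def normalized (q : ℕ → Vec d) : ℕ → Vec d := fun i => ‖q i‖⁻¹ • q i

theorem norm_normalized (q : ℕ → Vec d) (i : ℕ) :
    ‖normalized q i‖ = 1 ∨ normalized q i = 0 := by
  by_cases h : q i = 0
  · right; simp [normalized, h]
  · left
    rw [normalized, norm_smul, norm_inv, norm_norm, inv_mul_cancel₀ (norm_ne_zero_iff.2 h)]

theorem norm_normalized_le (q : ℕ → Vec d) (i : ℕ) : ‖normalized q i‖ ≤ 1 := by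
  rcases norm_normalized q i with h | h
  · exact h.le
  · simp [h]

theorem gam_nonneg (R : Submodule ℝ (Vec d)) (q : ℕ → Vec d) (l : ℕ) : 0 ≤ gam R q l := by
  obtain ⟨J, hJ, hD⟩ := (minDet_isLeast (normalized q) (block R q l)).1
  have h : minDet (normalized q) (block R q l) ≤ 1 :=
    hD.trans_le (gramDet_le_one (norm_normalized_le q) hJ.prop.2)
  exact sub_nonneg.2 h

theorem gam_lt_one (R : Submodule ℝ (Vec d)) (q : ℕ → Vec d) (l : ℕ) : gam R q l < 1 := by
  obtain ⟨J, hJ, hD⟩ := (minDet_isLeast (normalized q) (block R q l)).1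
  have h : 0 < minDet (normalized q) (block R q l) := (gramDet_pos hJ.prop.2).trans_eq hD.symm
  exact sub_lt_self _ h

theorem gam_succ {R : Submodule ℝ (Vec d)} {q : ℕ → Vec d}
    (h : ∀ l, cover R ((restart (cover R))^[l] q) ≠ ⊤) (l : ℕ) :
    gam R q (l + 1) = gam R ((restart (cover R))^[l] q) 1 := by
  have hI : Finset.Icc (start R q l) (start R q l +
        (cover R ((restart (cover R))^[l] q)).toNat) =
      (Finset.Icc 0 (cover R ((restart (cover R))^[l] q)).toNat).map
        (addLeftEmbedding (start R q l)) := by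
    rw [Finset.map_add_left_Icc, add_zero]
  unfold gam blockMinDet
  rw [block_succ h, block_one, hI, minDet_map]
  congr 2
  rw [iterate_restart_eq_shiftSeq]
  rfl

end MinDet

/-! ### Measurability and dependence on the block -/

section Measurability

variable {d : ℕ}

theorem measurable_gramDet (J : Finset ℕ) : Measurable fun v : ℕ → Vec d => gramDet v J := by
  refine Continuous.measurable ?_
  have h : Continuous fun v : ℕ → Vec d => colMatrix v J :=
    continuous_matrix fun i j => by simp only [colMatrix, Matrix.of_apply]; fun_prop
  exact (h.matrix_transpose.matrix_mul h).matrix_det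

theorem measurableSet_isMaxIndep (I J : Finset ℕ) :
    MeasurableSet {v : ℕ → Vec d | IsMaxIndep v I J} := by
  have h : ∀ K : Finset ℕ, MeasurableSet {v : ℕ → Vec d | gramDet v K ≠ 0} := fun K =>
    (measurable_gramDet K (measurableSet_singleton 0)).compl
  simp only [isMaxIndep_iff]
  rw [Set.ofPred_and, Set.ofPred_forall]
  refine ((MeasurableSet.const _).inter (h J)).inter ?_
  exact MeasurableSet.iInter fun K =>
    (MeasurableSet.const _).imp ((h K).imp (MeasurableSet.const _))

theorem measurable_minDet (I : Finset ℕ) : Measurable fun v : ℕ → Vec d => minDet v I := by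
  refine measurable_of_Iio fun c => ?_
  have : (fun v : ℕ → Vec d => minDet v I) ⁻¹' Set.Iio c =
      {v | ∃ J, IsMaxIndep v I J ∧ gramDet v J < c} := by
    ext v
    constructor
    · intro h
      obtain ⟨J, hJ, hD⟩ := (minDet_isLeast v I).1
      exact ⟨J, hJ, hD.symm.trans_lt h⟩
    · rintro ⟨J, hJ, hc⟩
      exact ((minDet_isLeast v I).2 ⟨J, hJ, rfl⟩).trans_lt hc
  rw [this, Set.ofPred_exists]
  exact MeasurableSet.iUnion fun J =>
    (measurableSet_isMaxIndep I J).inter (measurable_gramDet J measurableSet_Iio)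

/-- Spanning `R` is expressed by finitely many closed conditions and Gram determinants. -/
theorem span_image_eq_iff (R : Submodule ℝ (Vec d)) (v : ℕ → Vec d) (I : Finset ℕ) :
    Submodule.span ℝ (v '' I) = R ↔ (∀ i ∈ I, v i ∈ R) ∧
      ∃ J : Finset ℕ, (J ⊆ I ∧ J.card = Module.finrank ℝ R) ∧ gramDet v J ≠ 0 := by
  have hcard : ∀ J : Finset ℕ, gramDet v J ≠ 0 →
      Module.finrank ℝ (Submodule.span ℝ (v '' J)) = J.card := fun J hJ => by
    have hli : LinearIndependent ℝ fun j : J => v j :=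
      (linearIndepOn_iff_gramDet_ne_zero v J).2 hJ
    have := finrank_span_eq_card hli
    rw [Fintype.card_coe] at this
    rw [← this, show v '' J = Set.range fun j : J => v j by ext x; simp]
  constructor
  · rintro rfl
    refine ⟨fun i hi => Submodule.subset_span ⟨i, hi, rfl⟩, ?_⟩
    obtain ⟨b, hbI, -, hspan, hb⟩ := exists_linearIndepOn_extension
      (linearIndepOn_empty ℝ v) (Set.empty_subset (I : Set ℕ))
    obtain ⟨J, rfl⟩ := (I.finite_toSet.subset hbI).exists_finset_coe
    have hJ := (linearIndepOn_iff_gramDet_ne_zero v J).1 hb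
    refine ⟨J, ⟨by exact_mod_cast hbI, ?_⟩, hJ⟩
    rw [← hcard J hJ, (Submodule.span_mono (Set.image_mono hbI)).antisymm
      (Submodule.span_le.2 hspan)]
  · rintro ⟨hI, J, ⟨hJI, hJc⟩, hJ⟩
    have hle : Submodule.span ℝ (v '' I) ≤ R := by
      rw [Submodule.span_le]
      rintro _ ⟨i, hi, rfl⟩
      exact hI i hi
    have hle' : Submodule.span ℝ (v '' J) ≤ Submodule.span ℝ (v '' I) :=
      Submodule.span_mono (Set.image_mono (by exact_mod_cast hJI))
    have heq := Submodule.eq_of_le_of_finrank_eq (hle'.trans hle) ((hcard J hJ).trans hJc)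
    exact hle.antisymm (heq ▸ hle')

theorem measurableSet_span_image_eq (R : Submodule ℝ (Vec d)) (I : Finset ℕ) :
    MeasurableSet {v : ℕ → Vec d | Submodule.span ℝ (v '' I) = R} := by
  simp only [span_image_eq_iff]
  have hR : MeasurableSet (R : Set (Vec d)) := R.closed_of_finiteDimensional.measurableSet
  rw [Set.ofPred_and, Set.ofPred_forall, Set.ofPred_exists]
  refine MeasurableSet.inter ?_ ?_
  · exact MeasurableSet.iInter fun i => (MeasurableSet.const _).imp (measurable_pi_apply i hR)
  · exact MeasurableSet.iUnion fun J => (MeasurableSet.const _).inter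
      (measurable_gramDet J (measurableSet_singleton 0)).compl

theorem isStopping_cover (R : Submodule ℝ (Vec d)) : IsStopping (cover R) where
  measurable := by
    have h : ∀ k : ℕ, MeasurableSet {y : ℕ → Vec d | cover R y = k} := fun k => by
      simp only [cover_eq_iff, ← Finset.coe_Iic]
      rw [Set.ofPred_and, Set.ofPred_forall]
      refine (measurableSet_span_image_eq R _).inter ?_
      exact MeasurableSet.iInter fun j =>
        (MeasurableSet.const _).imp (measurableSet_span_image_eq R _).compl
    refine measurable_to_countable' fun t => ?_
    induction t using ENat.recTopCoe with
    | coe k => exact h k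
    | top =>
      have : cover R ⁻¹' {⊤} = {y : ℕ → Vec d | ∃ k : ℕ, cover R y = k}ᶜ := by
        ext y
        simp only [Set.mem_preimage, Set.mem_singleton_iff, Set.mem_compl_iff, Set.mem_ofPred_eq]
        rw [← not_iff_not, not_not, ← ne_eq, ENat.ne_top_iff_exists]
        exact exists_congr fun k => eq_comm
      rw [this]
      rw [Set.ofPred_exists]
      exact (MeasurableSet.iUnion h).compl
  eq_iff_stopSeq y k := by
    have h : ∀ j ≤ k, stopSeq k y '' Set.Iic j = y '' Set.Iic j := fun j hj =>
      Set.image_congr fun i hi => by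
        rw [stopSeq, min_eq_left (le_trans hi hj)]
    rw [cover_eq_iff, cover_eq_iff, h k le_rfl]
    exact and_congr_right fun _ => forall₂_congr fun j hj => by rw [h j hj.le]

theorem measurable_normalized : Measurable (normalized : (ℕ → Vec d) → ℕ → Vec d) :=
  measurable_pi_lambda _ fun i =>
    (measurable_pi_apply i).norm.inv.smul (measurable_pi_apply i)

theorem measurable_gam_one (R : Submodule ℝ (Vec d)) : Measurable fun y => gam R y 1 := by
  have h : ∀ k, Measurable fun y : ℕ → Vec d => 1 - minDet (normalized y) (Finset.Icc 0 k) :=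
    fun k => measurable_const.sub ((measurable_minDet _).comp measurable_normalized)
  have h' : Measurable fun y : ℕ → Vec d => (cover R y).toNat :=
    Measurable.of_discrete.comp (isStopping_cover R).measurable (g := ENat.toNat)
  have h'' : (fun y => gam R y 1) = fun y =>
      1 - minDet (normalized y) (Finset.Icc 0 (cover R y).toNat) := by
    funext y
    rw [gam, blockMinDet, block_one]
    rfl
  rw [h'']
  exact measurable_apply_nat h h'

theorem dependsUpTo_gam_one (R : Submodule ℝ (Vec d)) :
    DependsUpTo (cover R) fun y => gam R y 1 := by
  intro y k hk
  simp only [gam, blockMinDet, block_one, ((isStopping_cover R).eq_iff_stopSeq y k).1 hk, hk]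
  congr 1
  refine minDet_congr fun i hi => ?_
  have : min i k = i := min_eq_left (by simpa using hi)
  simp only [stopSeq, this]

theorem dependsUpTo_toNat_cover (R : Submodule ℝ (Vec d)) :
    DependsUpTo (cover R) fun y => ((cover R y).toNat : ℝ) := by
  intro y k hk
  simp only [((isStopping_cover R).eq_iff_stopSeq y k).1 hk, hk]

theorem measurable_toNat_cover (R : Submodule ℝ (Vec d)) :
    Measurable fun y => ((cover R y).toNat : ℝ) :=
  Measurable.of_discrete.comp (isStopping_cover R).measurable (g := fun t : ℕ∞ => (t.toNat : ℝ))

end Measurability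

/-! ### Integrability of the covering time -/

section Tails

variable {d : ℕ} {ν : Measure (Vec d)} {R : Submodule ℝ (Vec d)}

/-- Points of the support that form a basis of its span have neighbourhoods of positive measure
such that every choice of one point in each neighbourhood is linearly independent. -/
theorem exists_open_linearIndependent (hR : Submodule.span ℝ ν.support = R) :
    ∃ U : Fin (Module.finrank ℝ R) → Set (Vec d), (∀ i, IsOpen (U i)) ∧ (∀ i, 0 < ν (U i)) ∧
      ∀ u : Fin (Module.finrank ℝ R) → Vec d, (∀ i, u i ∈ U i) → LinearIndependent ℝ u := by
  subst hR
  obtain ⟨f, hf, -, hli⟩ := Submodule.exists_fun_fin_finrank_span_eq ℝ ν.support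
  have hopen := isOpen_setOfPred_linearIndependent (𝕜 := ℝ) (E := Vec d)
    (ι := Fin (Module.finrank ℝ (Submodule.span ℝ ν.support)))
  obtain ⟨U, hU, hUs⟩ := isOpen_pi_iff'.1 hopen f hli
  refine ⟨U, fun i => (hU i).1, fun i => ?_, fun u hu => hUs fun i _ => hu i⟩
  exact (Measure.mem_support_iff_forall _).1 (hf i) _ ((hU i).1.mem_nhds (hU i).2)

variable [IsProbabilityMeasure ν]

theorem ae_iidLaw_of_ae {p : Vec d → Prop} (h : ∀ᵐ x ∂ν, p x) :
    ∀ᵐ y ∂iidLaw ν, ∀ i, p (y i) := by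
  refine ae_all_iff.2 fun i => ?_
  have hmap : (iidLaw ν).map (fun y => y i) = ν := Measure.infinitePi_map_eval (fun _ : ℕ => ν) i
  rw [← hmap] at h
  exact ae_of_ae_map (measurable_pi_apply i).aemeasurable h

theorem iidLaw_forall_le_mem {U : Set (Vec d)} (hU : MeasurableSet U) (k : ℕ) :
    iidLaw ν {y | ∀ j ≤ k, y j ∈ U} = ν U ^ (k + 1) := by
  have h := Measure.infinitePi_pi (fun _ : ℕ => ν) (s := Finset.Iic k) (t := fun _ => U)
    fun _ _ => hU
  have hset : Set.pi (Finset.Iic k : Finset ℕ) (fun _ => U) =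
      {y : ℕ → Vec d | ∀ j ≤ k, y j ∈ U} := by
    ext y; simp [Set.mem_pi]
  rw [hset] at h
  rw [iidLaw, h]
  simp

/-- The tail of the covering time is dominated by geometric tails: the vectors `y_0, …, y_k` span
`R` as soon as each of the neighbourhoods `U_i` has been visited. -/
theorem tsum_iidLaw_lt_cover_lt_top (hR : Submodule.span ℝ ν.support = R) :
    ∑' k : ℕ, iidLaw ν {y | (k : ℕ∞) < cover R y} < ⊤ := by
  obtain ⟨U, hUo, hUpos, hUli⟩ := exists_open_linearIndependent hR
  have hmem : ∀ᵐ y ∂iidLaw ν, ∀ i, y i ∈ R := by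
    refine ae_iidLaw_of_ae ?_
    filter_upwards [Measure.support_mem_ae (μ := ν)] with x hx
    exact hR ▸ Submodule.subset_span hx
  have hle : ∀ k : ℕ, iidLaw ν {y | (k : ℕ∞) < cover R y} ≤ ∑ i, ν (U i)ᶜ ^ (k + 1) := by
    intro k
    calc iidLaw ν {y | (k : ℕ∞) < cover R y}
        ≤ iidLaw ν (⋃ i, {y | ∀ j ≤ k, y j ∈ (U i)ᶜ}) := by
          refine measure_mono_ae ?_
          filter_upwards [hmem] with y hy hk
          by_contra hcon
          have hvisit : ∀ i, ∃ j ≤ k, y j ∈ U i := by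
            intro i
            by_contra! hi
            exact hcon (Set.mem_iUnion.2 ⟨i, hi⟩)
          choose j hj hjU using hvisit
          have hli := hUli (fun i => y (j i)) hjU
          have hspan : Submodule.span ℝ (y '' Set.Iic k) = R := by
            have hle : Submodule.span ℝ (y '' Set.Iic k) ≤ R := by
              rw [Submodule.span_le]
              rintro _ ⟨i, -, rfl⟩
              exact hy i
            have hle' : Submodule.span ℝ (Set.range fun i => y (j i)) ≤
                Submodule.span ℝ (y '' Set.Iic k) :=
              Submodule.span_mono (by rintro _ ⟨i, rfl⟩; exact ⟨j i, hj i, rfl⟩)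
            have hfr := finrank_span_eq_card hli
            rw [Fintype.card_fin] at hfr
            have heq := Submodule.eq_of_le_of_finrank_eq (hle'.trans hle) hfr
            exact hle.antisymm (heq.symm.le.trans hle')
          refine absurd hk (not_lt.2 ?_)
          exact sInf_le ⟨k, rfl, zero_le, by simpa [Set.Iic] using hspan⟩
      _ ≤ ∑ i, iidLaw ν {y | ∀ j ≤ k, y j ∈ (U i)ᶜ} := measure_iUnion_fintype_le _ _
      _ = ∑ i, ν (U i)ᶜ ^ (k + 1) :=
          Finset.sum_congr rfl fun i _ => iidLaw_forall_le_mem (hUo i).measurableSet.compl k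
  refine (ENNReal.tsum_le_tsum hle).trans_lt ?_
  rw [Summable.tsum_finsetSum fun _ _ => ENNReal.summable]
  refine ENNReal.sum_lt_top.2 fun i _ => ?_
  have hlt : ν (U i)ᶜ < 1 := by
    rw [prob_compl_eq_one_sub (hUo i).measurableSet]
    exact ENNReal.sub_lt_self ENNReal.one_ne_top one_ne_zero (hUpos i).ne'
  simp only [pow_succ, ENNReal.tsum_mul_right, ENNReal.tsum_geometric]
  exact ENNReal.mul_lt_top (ENNReal.inv_lt_top.2 (tsub_pos_of_lt hlt))
    (hlt.trans ENNReal.one_lt_top)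

theorem ae_cover_ne_top (hR : Submodule.span ℝ ν.support = R) :
    ∀ᵐ y ∂iidLaw ν, cover R y ≠ ⊤ := by
  have h := ENNReal.tendsto_atTop_zero_of_tsum_ne_top (tsum_iidLaw_lt_cover_lt_top hR).ne
  rw [ae_iff]
  refine le_antisymm (ge_of_tendsto' h fun k => measure_mono fun y hy => ?_) zero_le
  rw [Set.mem_ofPred_eq, not_not] at hy
  rw [Set.mem_ofPred_eq, hy]
  exact ENat.natCast_lt_top k

theorem integrable_toNat_cover (hR : Submodule.span ℝ ν.support = R) :
    Integrable (fun y => ((cover R y).toNat : ℝ)) (iidLaw ν) := by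
  refine ⟨(measurable_toNat_cover R).aestronglyMeasurable, ?_⟩
  have hm : ∀ k : ℕ, MeasurableSet {y | (k : ℕ∞) < cover R y} := fun k =>
    (isStopping_cover R).measurable (.of_discrete (s := Set.Ioi (k : ℕ∞)))
  refine lt_of_le_of_lt ?_ (tsum_iidLaw_lt_cover_lt_top hR)
  calc ∫⁻ y, ‖((cover R y).toNat : ℝ)‖ₑ ∂iidLaw ν
      ≤ ∫⁻ y, ∑' k : ℕ, {y | (k : ℕ∞) < cover R y}.indicator 1 y ∂iidLaw ν := by
        refine lintegral_mono fun y => ?_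
        have h1 : ‖((cover R y).toNat : ℝ)‖ₑ = ((cover R y).toNat : ℝ≥0∞) := by
          rw [Real.enorm_eq_ofReal (Nat.cast_nonneg _), ENNReal.ofReal_natCast]
        rw [h1]
        -- If the covering time is `⊤`, its `toNat` is `0` and the bound is trivial.
        calc ((cover R y).toNat : ℝ≥0∞)
            = ∑ k ∈ Finset.range (cover R y).toNat,
                {y | (k : ℕ∞) < cover R y}.indicator (1 : (ℕ → Vec d) → ℝ≥0∞) y := by
              rw [Finset.sum_congr rfl fun k hk => Set.indicator_of_mem (?_ : _ ∈ _) _]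
              · simp
              · exact lt_of_lt_of_le (by exact_mod_cast Finset.mem_range.1 hk)
                  (ENat.natCast_toNat_le_self _)
          _ ≤ _ := ENNReal.sum_le_tsum _
    _ = ∑' k : ℕ, iidLaw ν {y | (k : ℕ∞) < cover R y} := by
        rw [lintegral_tsum fun k => (measurable_one.indicator (hm k)).aemeasurable]
        exact tsum_congr fun k => lintegral_indicator_one (hm k)

end Tails

/-! ### Contraction of the error over a block -/

section Contraction

variable {n d : ℕ} {R : Submodule ℝ (Vec d)}

theorem inner_mulV (A : Matrix (Fin n) (Fin d) ℝ) (u : Vec n) (x : Vec d) :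
    inner ℝ u (mulV A x) = inner ℝ (mulV A.transpose u) x := by
  simp only [mulV, EuclideanSpace.inner_eq_star_dotProduct, star_trivial]
  rw [Matrix.mulVec_transpose, dotProduct_comm, Matrix.dotProduct_mulVec, dotProduct_comm]

theorem mulV_sub (A : Matrix (Fin n) (Fin d) ℝ) (x y : Vec d) :
    mulV A (x - y) = mulV A x - mulV A y := by
  simp only [mulV, WithLp.ofLp_sub, Matrix.mulVec_sub, WithLp.toLp_sub]

/-- In the consistent case the error of the iteration evolves by the steps along the normalized
vectors `A' w_k`. -/
theorem iter_succ_sub {A : Matrix (Fin n) (Fin d) ℝ} {b : Vec n} {xstar : Vec d}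
    (hsol : mulV A xstar = b) (x₀ : Vec d) (w : ℕ → Vec n) (k : ℕ) :
    iter A b x₀ w (k + 1) - xstar =
      step (normalized (fun k => mulV A.transpose (w k)) k) (iter A b x₀ w k - xstar) := by
  have h : inner ℝ (w k) (b - mulV A (iter A b x₀ w k)) =
      -inner ℝ (mulV A.transpose (w k)) (iter A b x₀ w k - xstar) := by
    rw [← hsol, ← mulV_sub, inner_mulV, ← inner_neg_right, neg_sub]
  rw [iter, h, step, normalized, inner_smul_left, smul_smul, conj_trivial]
  set q := mulV A.transpose (w k)
  set e := iter A b x₀ w k - xstar with he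
  have hc : -inner ℝ q e / ‖q‖ ^ 2 = -(‖q‖⁻¹ * inner ℝ q e * ‖q‖⁻¹) := by
    rw [div_eq_mul_inv, ← inv_pow]
    ring
  rw [hc, neg_smul, he]
  abel

theorem iter_add_sub {A : Matrix (Fin n) (Fin d) ℝ} {b : Vec n} {xstar : Vec d}
    (hsol : mulV A xstar = b) (x₀ : Vec d) (w : ℕ → Vec n) (a m : ℕ) :
    iter A b x₀ w (a + m) - xstar =
      sweep (normalized fun k => mulV A.transpose (w k)) a m (iter A b x₀ w a - xstar) := by
  induction m generalizing a with
  | zero => rfl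
  | succ m ih =>
    rw [sweep, ← iter_succ_sub hsol, ← ih (a + 1)]
    congr 2
    omega

theorem span_image_normalized (q : ℕ → Vec d) (I : Set ℕ) :
    Submodule.span ℝ (normalized q '' I) = Submodule.span ℝ (q '' I) := by
  refine le_antisymm (Submodule.span_le.2 ?_) (Submodule.span_le.2 ?_)
  · rintro _ ⟨i, hi, rfl⟩
    exact Submodule.smul_mem _ _ (Submodule.subset_span ⟨i, hi, rfl⟩)
  · rintro _ ⟨i, hi, rfl⟩
    have h : q i = ‖q i‖ • normalized q i := by
      by_cases h0 : q i = 0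
      · simp [h0]
      · rw [normalized, smul_smul, mul_inv_cancel₀ (norm_ne_zero_iff.2 h0), one_smul]
    rw [SetLike.mem_coe, h]
    exact Submodule.smul_mem _ _ (Submodule.subset_span ⟨i, hi, rfl⟩)

theorem span_image_block {q : ℕ → Vec d} (h : ∀ l, cover R ((restart (cover R))^[l] q) ≠ ⊤)
    (l : ℕ) : Submodule.span ℝ (q '' block R q (l + 1)) = R := by
  have hc := (cover_eq_iff.1 (ENat.natCast_toNat (h l)).symm).1
  refine Eq.trans ?_ hc
  rw [block_succ h]
  generalize (cover R ((restart (cover R))^[l] q)).toNat = m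
  rw [iterate_restart_eq_shiftSeq]
  congr 1
  ext x
  constructor
  · rintro ⟨i, hi, rfl⟩
    rw [Finset.coe_Icc, Set.mem_Icc] at hi
    exact ⟨i - start R q l, Set.mem_Iic.2 (by omega), by simp only [shiftSeq]; congr 1; omega⟩
  · rintro ⟨i, hi, rfl⟩
    rw [Set.mem_Iic] at hi
    exact ⟨start R q l + i, by rw [Finset.coe_Icc, Set.mem_Icc]; omega, rfl⟩

/-- One block contracts the squared norm on `R` by the factor `γ`. -/
theorem norm_sweep_block_sq_le {q : ℕ → Vec d}
    (h : ∀ l, cover R ((restart (cover R))^[l] q) ≠ ⊤) (l : ℕ) {x : Vec d} (hx : x ∈ R) :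
    ‖sweep (normalized q) (start R q l) ((cover R ((restart (cover R))^[l] q)).toNat + 1) x‖ ^ 2 ≤
      gam R q (l + 1) * ‖x‖ ^ 2 := by
  obtain ⟨J, hJI, hJ, hspan, hle⟩ := exists_norm_sweep_sq_le (norm_normalized q) (start R q l)
    ((cover R ((restart (cover R))^[l] q)).toNat + 1)
  have hI : Finset.Ico (start R q l)
      (start R q l + ((cover R ((restart (cover R))^[l] q)).toNat + 1)) = block R q (l + 1) := by
    rw [block_succ h]
    ext i
    simp only [Finset.mem_Ico, Finset.mem_Icc]
    omega
  rw [hI] at hJI hspan hle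
  rw [span_image_normalized q (block R q (l + 1)), span_image_block h] at hspan hle
  refine (hle x hx).trans (mul_le_mul_of_nonneg_right ?_ (sq_nonneg _))
  have hmax : IsMaxIndep (normalized q) (block R q (l + 1)) J :=
    isMaxIndep_of_span_eq hJI hJ
      (by rw [hspan, span_image_normalized q (block R q (l + 1)), span_image_block h])
  exact sub_le_sub_left ((minDet_isLeast (normalized q) _).2 ⟨J, hmax, rfl⟩) 1

theorem norm_iter_start_sq_le {A : Matrix (Fin n) (Fin d) ℝ} {b : Vec n} {xstar : Vec d}
    (hsol : mulV A xstar = b) (x₀ : Vec d) (w : ℕ → Vec n) {q : ℕ → Vec d}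
    (hq : q = fun k => mulV A.transpose (w k)) {N : Submodule ℝ (Vec d)} (hN : R = Nᗮ)
    (hqR : ∀ k, q k ∈ R) (h : ∀ l, cover R ((restart (cover R))^[l] q) ≠ ⊤) (l : ℕ) :
    ‖iter A b x₀ w (start R q l) - xstar - N.starProjection (x₀ - xstar)‖ ^ 2 ≤
      (∏ i ∈ Finset.range l, gam R q (i + 1)) * ‖R.starProjection (x₀ - xstar)‖ ^ 2 := by
  set z := N.starProjection (x₀ - xstar) with hz
  have hzN : z ∈ N := Submodule.starProjection_apply_mem N _
  have hvR : ∀ i, normalized q i ∈ R := fun i => R.smul_mem _ (hqR i)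
  have hvz : ∀ i, inner ℝ (normalized q i) z = 0 := fun i =>
    Submodule.inner_left_of_mem_orthogonal hzN (hN ▸ hvR i)
  have hsweep : ∀ a m, iter A b x₀ w (a + m) - xstar - z =
      sweep (normalized q) a m (iter A b x₀ w a - xstar - z) := by
    intro a m
    rw [iter_add_sub hsol, ← hq, sub_eq_iff_eq_add,
      ← sweep_add_of_orthogonal _ a m fun i _ _ => hvz i, sub_add_cancel]
  have h0 : iter A b x₀ w 0 - xstar - z = R.starProjection (x₀ - xstar) := by
    rw [iter, hN, Submodule.starProjection_orthogonal_val]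
  have hmem : ∀ a, iter A b x₀ w a - xstar - z ∈ R := by
    intro a
    rw [← Nat.zero_add a, hsweep 0 a, h0]
    exact sweep_mem 0 a (fun i _ _ => hvR i) (Submodule.starProjection_apply_mem R _)
  induction l with
  | zero => simp [start, h0]
  | succ l ih =>
    rw [start_succ, hsweep, Finset.prod_range_succ, mul_comm (Finset.prod _ _), mul_assoc]
    exact (norm_sweep_block_sq_le h l (hmem _)).trans
      (mul_le_mul_of_nonneg_left ih (gam_nonneg R q _))

end Contraction

/-! ### Products and averages -/

section Averages

/-- By the inequality of arithmetic and geometric means, a product of factors whose averages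
converge to `ρ` is eventually at most `ρ^{l/δ}`. -/
theorem eventually_prod_le_rpow {a : ℕ → ℝ} (ha : ∀ i, 0 ≤ a i) {ρ δ : ℝ} (hρ0 : 0 < ρ)
    (hρ1 : ρ < 1) (hδ : 1 < δ)
    (h : Tendsto (fun l : ℕ => (∑ i ∈ Finset.range l, a i) / l) atTop (𝓝 ρ)) :
    ∀ᶠ l : ℕ in atTop, ∏ i ∈ Finset.range l, a i ≤ ρ ^ ((l : ℝ) / δ) := by
  have hlt : ρ < ρ ^ (1 / δ) := by
    conv_lhs => rw [← Real.rpow_one ρ]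
    exact Real.rpow_lt_rpow_of_exponent_gt hρ0 hρ1 (by rw [div_lt_one (by linarith)]; exact hδ)
  filter_upwards [h.eventually_le_const hlt, eventually_gt_atTop 0] with l hl hl0
  have hl0' : (0 : ℝ) < l := by exact_mod_cast hl0
  have hsum : ∑ _i ∈ Finset.range l, (1 / l : ℝ) = 1 := by
    rw [Finset.sum_const, Finset.card_range, nsmul_eq_mul, mul_one_div_cancel hl0'.ne']
  have hamgm := Real.geom_mean_le_arith_mean_weighted (Finset.range l) (fun _ => (1 / l : ℝ)) a
    (fun _ _ => by positivity) hsum fun i _ => ha i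
  rw [← Finset.mul_sum, one_div_mul_eq_div, Real.finsetProd_rpow _ _ fun i _ => ha i] at hamgm
  have hP : 0 ≤ ∏ i ∈ Finset.range l, a i := Finset.prod_nonneg fun i _ => ha i
  calc ∏ i ∈ Finset.range l, a i = ((∏ i ∈ Finset.range l, a i) ^ (1 / l : ℝ)) ^ (l : ℝ) := by
        rw [← Real.rpow_mul hP, one_div_mul_cancel hl0'.ne', Real.rpow_one]
    _ ≤ (ρ ^ (1 / δ)) ^ (l : ℝ) :=
        Real.rpow_le_rpow (Real.rpow_nonneg hP _) (hamgm.trans hl) hl0'.le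
    _ = ρ ^ ((l : ℝ) / δ) := by rw [← Real.rpow_mul hρ0.le, one_div_mul_eq_div]

end Averages

/-! ### Transfer along a measurable map -/

section Transfer

variable {Ω X : Type*} [MeasurableSpace Ω] [MeasurableSpace X] {μ : Measure Ω}

theorem iIndepFun_comp_of_map {ι β : Type*} [MeasurableSpace β] {Q : Ω → X} (hQ : Measurable Q)
    {g : ι → X → β} (hg : ∀ i, Measurable (g i)) (h : iIndepFun g (μ.map Q)) :
    iIndepFun (fun i ω => g i (Q ω)) μ := by
  rw [iIndepFun_iff_measure_inter_preimage_eq_mul] at h ⊢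
  intro F A hA
  have := h F hA
  rw [Measure.map_apply hQ (Finset.measurableSet_biInter _ fun i hi => hg i (hA i hi))] at this
  simp only [Set.preimage_iInter] at this
  refine this.trans (Finset.prod_congr rfl fun i hi => ?_)
  rw [Measure.map_apply hQ (hg i (hA i hi))]
  rfl

theorem identDistrib_comp_of_map {β : Type*} [MeasurableSpace β] {Q : Ω → X} (hQ : Measurable Q)
    {g g' : X → β} (hg : Measurable g) (hg' : Measurable g')
    (h : IdentDistrib g g' (μ.map Q) (μ.map Q)) :
    IdentDistrib (fun ω => g (Q ω)) (fun ω => g' (Q ω)) μ μ where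
  aemeasurable_fst := (hg.comp hQ).aemeasurable
  aemeasurable_snd := (hg'.comp hQ).aemeasurable
  map_eq := by
    have := h.map_eq
    rwa [Measure.map_map hg hQ, Measure.map_map hg' hQ] at this

end Transfer

/-! ### The row space and the support of the law -/

section Subspace

variable {Ω : Type*} [MeasurableSpace Ω] {μ : Measure Ω} {n d : ℕ}

theorem measurable_mulV (M : Matrix (Fin d) (Fin n) ℝ) : Measurable (mulV M) := by
  refine Continuous.measurable ?_
  unfold mulV
  exact (PiLp.continuous_toLp 2 _).comp (Continuous.matrix_mulVec continuous_const
    (PiLp.continuous_ofLp 2 _))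

theorem nullSpan_eq (A : Matrix (Fin n) (Fin d) ℝ) {w : Ω → Vec n} (hw : Measurable w) :
    nullSpan μ A w =
      (Submodule.span ℝ (μ.map fun ω => mulV A.transpose (w ω)).support)ᗮ := by
  set ν := μ.map fun ω => mulV A.transpose (w ω)
  have hset : {z : Vec d | ∀ᵐ ω ∂μ, inner ℝ z (mulV A.transpose (w ω)) = 0} =
      ((Submodule.span ℝ ν.support)ᗮ : Submodule ℝ (Vec d)) := by
    ext z
    have hcl : IsClosed {x : Vec d | inner ℝ z x = 0} :=
      isClosed_eq (by fun_prop) continuous_const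
    have hiff : (∀ᵐ ω ∂μ, inner ℝ z (mulV A.transpose (w ω)) = 0) ↔
        ∀ᵐ x ∂ν, inner ℝ z x = 0 :=
      (ae_map_iff ((measurable_mulV _).comp hw).aemeasurable hcl.measurableSet).symm
    rw [Set.mem_ofPred_eq, hiff, SetLike.mem_coe, Submodule.mem_orthogonal']
    constructor
    · intro h u hu
      have hsub := Measure.support_subset_of_isClosed hcl h
      refine Submodule.span_induction (p := fun u _ => inner ℝ z u = 0) (fun x hx => hsub hx)
        (inner_zero_right _) (fun x y _ _ hx hy => ?_) (fun c x _ hx => ?_) hu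
      · rw [inner_add_right, hx, hy, add_zero]
      · rw [inner_smul_right, hx, mul_zero]
    · intro h
      filter_upwards [Measure.support_mem_ae (μ := ν)] with x hx
      exact h x (Submodule.subset_span hx)
  rw [nullSpan, hset, Submodule.span_eq]

theorem rowSpan_eq (A : Matrix (Fin n) (Fin d) ℝ) {w : Ω → Vec n} (hw : Measurable w) :
    rowSpan μ A w = Submodule.span ℝ (μ.map fun ω => mulV A.transpose (w ω)).support := by
  rw [rowSpan, nullSpan_eq A hw, Submodule.orthogonal_orthogonal]

end Subspace

/-! ### The law of the projected sequence -/

section Assembly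

variable {Ω : Type*} [MeasurableSpace Ω] {μ : Measure Ω} {n d : ℕ}

theorem map_seq_eq_iidLaw (A : Matrix (Fin n) (Fin d) ℝ) {w : Ω → Vec n} {ws : ℕ → Ω → Vec n}
    (hws : ∀ k, Measurable (ws k)) (hindep : iIndepFun ws μ)
    (hident : ∀ k, IdentDistrib (ws k) w μ μ) :
    μ.map (fun ω k => mulV A.transpose (ws k ω)) =
      iidLaw (μ.map fun ω => mulV A.transpose (w ω)) := by
  have hm := measurable_mulV A.transpose
  have h := (hindep.comp (fun _ => mulV A.transpose) fun _ => hm).map_fun_eq_infinitePi_map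
    fun k => hm.comp (hws k)
  rw [iidLaw]
  refine h.trans ?_
  congr 1
  funext k
  exact ((hident k).comp hm).map_eq

end Assembly

end RowAction

open RowAction MeasureTheory ProbabilityTheory Filter Topology in
theorem mainTheorem8 {Ω : Type*} [MeasurableSpace Ω] (μ : MeasureTheory.Measure Ω)
    [MeasureTheory.IsProbabilityMeasure μ] {n d : ℕ}
    (A : Matrix (Fin n) (Fin d) ℝ) (b : RowAction.Vec n)
    (xstar : RowAction.Vec d) (hsol : RowAction.mulV A xstar = b)
    (x₀ : RowAction.Vec d)
    (w : Ω → RowAction.Vec n) (ws : ℕ → Ω → RowAction.Vec n)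
    (hw : Measurable w) (hws : ∀ k, Measurable (ws k))
    (hindep : ProbabilityTheory.iIndepFun ws μ)
    (hident : ∀ k, ProbabilityTheory.IdentDistrib (ws k) w μ μ) :
    -- all stopping times are finite almost surely
    (∀ l : ℕ, ∀ᵐ ω ∂μ, RowAction.rtau μ A w ws l ω < ⊤) ∧
    -- `γ_1, γ_2, …` are independent and identically distributed
    ProbabilityTheory.iIndepFun (fun l : ℕ => RowAction.rgam μ A w ws (l + 1)) μ ∧
    (∀ l : ℕ, 1 ≤ l → ProbabilityTheory.IdentDistrib
      (RowAction.rgam μ A w ws l) (RowAction.rgam μ A w ws 1) μ μ) ∧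
    -- the expectation of `γ_ℓ`
    (∀ l : ℕ, 1 ≤ l → MeasureTheory.Integrable (RowAction.rgam μ A w ws l) μ ∧
      (∫ ω, RowAction.rgam μ A w ws l ω ∂μ) ∈ Set.Ico (0 : ℝ) 1) ∧
    (∫ ω, RowAction.rgam μ A w ws 1 ω ∂μ) = 1 - ∫ ω, RowAction.rminDet μ A w ws 1 ω ∂μ ∧
    -- the rate of convergence
    (∀ δ : ℝ, 1 < δ → ∀ᵐ ω ∂μ, ∀ᶠ l : ℕ in Filter.atTop,
      ‖RowAction.iter A b x₀ (fun k => ws k ω) ((RowAction.rtau μ A w ws l ω).toNat + 1) - xstar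
          - (RowAction.nullSpan μ A w).starProjection (x₀ - xstar)‖ ^ 2
        ≤ (∫ ω', RowAction.rgam μ A w ws 1 ω' ∂μ) ^ ((l : ℝ) / δ) *
          ‖(RowAction.rowSpan μ A w).starProjection (x₀ - xstar)‖ ^ 2) ∧
    -- the growth of the stopping times
    MeasureTheory.Integrable (fun ω => ((RowAction.rtau μ A w ws 1 ω).toNat : ℝ)) μ ∧
    (∀ᵐ ω ∂μ, Filter.Tendsto
      (fun l : ℕ => ((RowAction.rtau μ A w ws l ω).toNat : ℝ) / (l : ℝ)) Filter.atTop
      (nhds ((∫ ω', ((RowAction.rtau μ A w ws 1 ω').toNat : ℝ) ∂μ) + 1))) := by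
  set R := rowSpan μ A w
  set Q : Ω → ℕ → Vec d := fun ω k => mulV A.transpose (ws k ω)
  set ν := μ.map fun ω => mulV A.transpose (w ω)
  have hQ : Measurable Q :=
    measurable_pi_lambda _ fun k => (measurable_mulV A.transpose).comp (hws k)
  have : IsProbabilityMeasure ν :=
    Measure.isProbabilityMeasure_map ((measurable_mulV A.transpose).comp hw).aemeasurable
  have hlaw : μ.map Q = iidLaw ν := map_seq_eq_iidLaw A hws hindep hident
  have hspan : Submodule.span ℝ ν.support = R := (rowSpan_eq A hw).symm
  have hT := isStopping_cover R
  have hfin : ∀ᵐ y ∂iidLaw ν, cover R y ≠ ⊤ := ae_cover_ne_top hspan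
  have hall : ∀ᵐ ω ∂μ, ∀ l, cover R ((restart (cover R))^[l] (Q ω)) ≠ ⊤ := by
    have h := ae_forall_iterate_restart_ne_top hT hfin
    rw [← hlaw] at h
    exact ae_of_ae_map hQ.aemeasurable h
  have hmem : ∀ᵐ ω ∂μ, ∀ k, Q ω k ∈ R := by
    have h : ∀ᵐ x ∂ν, x ∈ R := by
      filter_upwards [Measure.support_mem_ae (μ := ν)] with x hx
      exact hspan ▸ Submodule.subset_span hx
    have h' := ae_iidLaw_of_ae h
    rw [← hlaw] at h'
    exact ae_of_ae_map hQ.aemeasurable h'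
  -- A functional of the first block, evaluated on the successive blocks, gives an i.i.d. sequence.
  have hiid : ∀ g : (ℕ → Vec d) → ℝ, Measurable g → DependsUpTo (cover R) g →
      iIndepFun (fun l ω => g ((restart (cover R))^[l] (Q ω))) μ ∧
      ∀ l, IdentDistrib (fun ω => g ((restart (cover R))^[l] (Q ω))) (fun ω => g (Q ω)) μ μ := by
    intro g hg hgT
    have hgm : ∀ l, Measurable fun y => g ((restart (cover R))^[l] y) := fun l =>
      hg.comp (measurable_iterate_restart hT l)
    refine ⟨iIndepFun_comp_of_map hQ hgm ?_, fun l => identDistrib_comp_of_map hQ (hgm l) hg ?_⟩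
    · rw [hlaw]
      exact iIndepFun_iterate_restart hT hfin hg hgT
    · rw [hlaw]
      exact identDistrib_iterate_restart hT hfin hg l
  obtain ⟨hγind, hγid⟩ := hiid _ (measurable_gam_one R) (dependsUpTo_gam_one R)
  obtain ⟨hτind, hτid⟩ := hiid _ (measurable_toNat_cover R) (dependsUpTo_toNat_cover R)
  have hγae : ∀ l, rgam μ A w ws (l + 1) =ᵐ[μ]
      fun ω => gam R ((restart (cover R))^[l] (Q ω)) 1 := fun l => by
    filter_upwards [hall] with ω hω
    exact gam_succ hω l
  have hind : iIndepFun (fun l : ℕ => rgam μ A w ws (l + 1)) μ :=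
    hγind.congr fun l => (hγae l).symm
  have hid : ∀ l : ℕ, IdentDistrib (rgam μ A w ws (l + 1)) (rgam μ A w ws 1) μ μ := fun l =>
    (IdentDistrib.of_ae_eq ((hγid l).aemeasurable_fst.congr (hγae l).symm) (hγae l)).trans (hγid l)
  have hγ0 : ∀ l ω, 0 ≤ rgam μ A w ws l ω := fun l ω => gam_nonneg _ _ _
  have hγ1 : ∀ l ω, rgam μ A w ws l ω < 1 := fun l ω => gam_lt_one _ _ _
  have hint : ∀ l : ℕ, Integrable (rgam μ A w ws (l + 1)) μ := fun l =>
    Integrable.of_bound (hid l).aemeasurable_fst.aestronglyMeasurable 1 <| ae_of_all _ fun ω => by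
      rw [Real.norm_of_nonneg (hγ0 _ _)]
      exact (hγ1 _ _).le
  have hnonneg : ∀ l : ℕ, 0 ≤ ∫ ω, rgam μ A w ws l ω ∂μ := fun l =>
    integral_nonneg (hγ0 l)
  have hlt : ∀ l : ℕ, ∫ ω, rgam μ A w ws (l + 1) ω ∂μ < 1 := fun l => by
    have hpos : 0 < ∫ ω, (1 - rgam μ A w ws (l + 1) ω) ∂μ := by
      rw [integral_pos_iff_support_of_nonneg (fun ω => (sub_pos.2 (hγ1 _ ω)).le)
        ((integrable_const 1).sub (hint l))]
      have : Function.support (fun ω => 1 - rgam μ A w ws (l + 1) ω) = Set.univ :=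
        Set.eq_univ_of_forall fun ω => (sub_pos.2 (hγ1 _ ω)).ne'
      rw [this, measure_univ]
      exact one_pos
    rw [integral_sub (integrable_const 1) (hint l)] at hpos
    simpa using hpos
  have hτint : Integrable (fun ω => ((cover R (Q ω)).toNat : ℝ)) μ := by
    have h := integrable_toNat_cover hspan
    rw [← hlaw] at h
    exact h.comp_measurable hQ
  refine ⟨fun l => ?_, hind, fun l hl => ?_, fun l hl => ?_, ?_, fun δ hδ => ?_, hτint, ?_⟩
  · rcases l with _ | l
    · exact ae_of_all _ fun ω => ENat.natCast_lt_top 0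
    · filter_upwards [hall] with ω hω
      exact (tau_succ hω l).trans_lt (ENat.natCast_lt_top _)
  · obtain ⟨l, rfl⟩ := Nat.exists_eq_succ_of_ne_zero (Nat.one_le_iff_ne_zero.1 hl)
    exact hid l
  · obtain ⟨l, rfl⟩ := Nat.exists_eq_succ_of_ne_zero (Nat.one_le_iff_ne_zero.1 hl)
    exact ⟨hint l, hnonneg _, hlt l⟩
  · have h : rminDet μ A w ws 1 = fun ω => 1 - rgam μ A w ws 1 ω := by
      funext ω
      exact (sub_sub_cancel 1 _).symm
    rw [h, integral_sub (integrable_const 1) (hint 0)]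
    simp
  · have hslln := strong_law_ae_real (fun l => rgam μ A w ws (l + 1)) (hint 0)
      (fun i j hij => hind.indepFun hij) hid
    have hprod : ∀ᵐ ω ∂μ, ∀ᶠ l : ℕ in atTop, ∏ i ∈ Finset.range l, rgam μ A w ws (i + 1) ω ≤
        (∫ ω', rgam μ A w ws 1 ω' ∂μ) ^ ((l : ℝ) / δ) := by
      rcases (hnonneg 1).eq_or_lt with h0 | h0
      · -- If `𝔼 γ_1 = 0`, then `γ_1 = 0` almost surely, and the product vanishes from `l = 1` on.
        have hz := (integral_eq_zero_iff_of_nonneg (hγ0 1) (hint 0)).1 h0.symm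
        filter_upwards [hz] with ω hω
        filter_upwards [eventually_gt_atTop 0] with l hl
        rw [Finset.prod_eq_zero (Finset.mem_range.2 hl) hω]
        exact Real.rpow_nonneg (hnonneg 1) _
      · filter_upwards [hslln] with ω hω
        exact eventually_prod_le_rpow (fun i => hγ0 _ _) h0 (hlt 0) hδ hω
    filter_upwards [hprod, hall, hmem] with ω hω hfinω hmemω
    filter_upwards [hω, eventually_gt_atTop 0] with l hl hl0
    obtain ⟨l, rfl⟩ := Nat.exists_eq_succ_of_ne_zero hl0.ne'
    have hstart : (rtau μ A w ws (l + 1) ω).toNat + 1 = start R (Q ω) (l + 1) :=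
      toNat_tau_succ_add_one hfinω l
    rw [Nat.succ_eq_add_one, hstart]
    exact (norm_iter_start_sq_le hsol x₀ (fun k => ws k ω) rfl rfl hmemω hfinω (l + 1)).trans
      (mul_le_mul_of_nonneg_right hl (sq_nonneg _))
  · have hslln := strong_law_ae_real
      (fun l ω => ((cover R ((restart (cover R))^[l] (Q ω))).toNat : ℝ)) hτint
      (fun i j hij => hτind.indepFun hij) hτid
    filter_upwards [hslln, hall] with ω hω hfinω
    have hlim := (hω.add_const 1).sub (tendsto_one_div_atTop_nhds_zero_nat (𝕜 := ℝ))
    rw [sub_zero] at hlim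
    refine hlim.congr' ?_
    filter_upwards [eventually_gt_atTop 0] with l hl0
    -- `τ_l + 1` is the sum of the lengths of the first `l` blocks.
    have hstart : ((rtau μ A w ws l ω).toNat : ℝ) + 1 = start R (Q ω) l := by
      obtain ⟨l, rfl⟩ := Nat.exists_eq_succ_of_ne_zero hl0.ne'
      exact_mod_cast toNat_tau_succ_add_one hfinω l
    have hl0' : (l : ℝ) ≠ 0 := by exact_mod_cast hl0.ne'
    rw [eq_sub_of_add_eq hstart, start]
    push_cast
    rw [Finset.sum_add_distrib, Finset.sum_const, Finset.card_range, nsmul_eq_mul, mul_one]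
    field_simp
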